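/- Conventions. For integrable $f$ on $\mathbb R$ let $\widetilde f(\xi)=\int_{\mathbb R}e^{ix\xi}f(x)\,dx$; an operator has symbol $m$ if it multiplies $\widetilde f(\xi)$ by $m(\xi)$ ($\xi\neq 0$). Results of the operators below are integrable continuous functions. For $\alpha\in(1,2]$ and $|\theta|\le 2-\alpha$ put $\psi_{\alpha,\theta}(\xi)=|\xi|^{\alpha}e^{i\,\mathrm{sign}(\xi)\theta\pi/2}$. The Riesz–Feller derivative $\mathcal D_x^{\alpha,\theta}$ has symbol $-\psi_{\alpha,\theta}(\xi)$; the fractional shift operator is $\mathcal O_{1,x}^{\alpha,\theta}=\sum_{n\ge 0}\frac1{n!}(\mathcal D_x^{\alpha,\theta})^n$, the series being summed on the side of Fourier transforms, so that its symbol is $e^{-\psi_{\alpha,\theta}(\xi)}$; for $0<\nu<1$, $|\gamma|\le\nu$, the Feller integral $I^{\nu}_{\gamma}$ has symbol $|\xi|^{-\nu}e^{-i\pi\gamma\,\mathrm{sign}(\xi)/2}$. The stable process $\mathcal S_\alpha^\theta$ has $\mathcal S_\alpha^\theta(0)=0$ and independent stationary increments, with $\mathbb E e^{i\xi \mathcal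 S_\alpha^\theta(t)}=e^{-t\psi_{\alpha,\theta}(\xi)}$; its transition density is $p_\alpha^\theta(x,t)$. Theorem. Let $a\ge0$, $\lambda>0$, let $B$ be a linear birth (Yule–Furry) process with one progenitor and rate $\lambda$ ($B(0)=1$, jumps $k\to k+1$ at rate $\lambda k$), independent of $\mathcal S_\alpha^\theta$, and let $\mathcal Y_\alpha^\theta(t)=\mathcal S_\alpha^\theta(at+B(t))$, $t\ge 0$. (i) Let $\alpha\in(1,2)$ and $\theta=2-\alpha$. Then $\mathcal Y_\alpha^\theta(t)$ has, for each $t\ge0$, a continuous density $u(\cdot,t)$, the terms below are well defined, and for all $x\in\mathbb R$, $t\ge0$ (with the right derivative at $t=0$) $$\partial_t u(x,t)=a\left[\mathcal D_x^{\alpha,\theta}+\lambda t\,(I-\mathcal O_{1,x}^{\alpha,\theta})\right]u(x,t)+\frac{\lambda}{\alpha}\,(I-\mathcal O_{1,x}^{\alpha,\theta})\,I^{\alpha-1}_{1-\alpha}[x\,u(x,t)],\qquad u(x,0)=p_\alpha^\theta(x,1).$$ Moreover, if $(1+at)\cos(\pi\theta/2)\ge1$, then both series $\sum_n\frac1{n!}(\mathcal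 D_x^{\alpha,\theta})^n$ (applied to $u(\cdot,t)$ and to $I^{\alpha-1}_{1-\alpha}[x\,u(x,t)]$) converge uniformly in $x$ to the respective values of $\mathcal O_{1,x}^{\alpha,\theta}$. (ii) Let $\alpha=2$ and $\theta=0$. Then $\mathcal Y_2^0(t)$ has, for each $t\ge0$, a continuous density $u(\cdot,t)$, and for all $x\in\mathbb R$, $t\ge0$ (with the right derivative at $t=0$) $$\partial_t u(x,t)=a\left[\partial_x^2+\lambda t\,(I-e^{\partial_x^2})\right]u(x,t)+\frac{\lambda}{2}\,(I-e^{\partial_x^2})\int_{-\infty}^{x}z\,u(z,t)\,dz,\qquad u(x,0)=\frac{1}{\sqrt{4\pi}}e^{-x^2/4},$$ where $e^{\partial_x^2}f=\sum_{n\ge0}\frac1{n!}\partial_x^{2n}f$, both series converging uniformly in $x$. -/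

import Mathlib

open MeasureTheory ProbabilityTheory Filter
open scoped NNReal ENNReal Topology

/-! ### Fourier transform and Fourier multiplier operators -/

/-- The Fourier transform `f̃(ξ) = ∫ e^{i x ξ} f(x) dx` of a real function (no `2π` in the
exponent, positive sign). -/
noncomputable def fourierPos (f : ℝ → ℝ) (ξ : ℝ) : ℂ :=
  ∫ x : ℝ, Complex.exp (Complex.I * ξ * x) * (f x : ℂ)

/-- `g` is the result of applying to `f` the pseudo-differential operator with symbol `m`:
both are integrable, and `g̃(ξ) = m(ξ) f̃(ξ)`. The frequency `ξ = 0`, where a symbol may be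
singular, is left out; this loses nothing, since `f̃` and `g̃` are continuous. The function `g` is
required to be continuous, so that it is determined by `f` at every point. -/
structure IsFourierMultiplier (m : ℝ → ℂ) (f g : ℝ → ℝ) : Prop where
  integrable_left : Integrable f
  integrable_right : Integrable g
  continuous_right : Continuous g
  fourier_eq : ∀ ξ : ℝ, ξ ≠ 0 → fourierPos g ξ = m ξ * fourierPos f ξ

/-- `ψ_{α,θ}(ξ) = |ξ|^α e^{i sign(ξ) θ π / 2}`. -/
noncomputable def psiSymbol (α θ ξ : ℝ) : ℂ :=
  ((|ξ| ^ α : ℝ) : ℂ) * Complex.exp (Complex.I * ((Real.sign ξ * θ * Real.pi / 2 : ℝ) : ℂ))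

/-- `g = 𝒟^{α,θ} f`, the Riesz-Feller fractional derivative: the operator with symbol
`-ψ_{α,θ}`. -/
def IsRieszFeller (α θ : ℝ) (f g : ℝ → ℝ) : Prop :=
  IsFourierMultiplier (fun ξ => -psiSymbol α θ ξ) f g

/-- `g = I_γ^ν f`, the Feller integral: the operator with symbol
`|ξ|^{-ν} e^{-i π γ sign(ξ) / 2}`. -/
def IsFellerIntegral (ν γ : ℝ) (f g : ℝ → ℝ) : Prop :=
  IsFourierMultiplier
    (fun ξ => ((|ξ| ^ (-ν) : ℝ) : ℂ) *
      Complex.exp (-(Complex.I * ((Real.pi * γ * Real.sign ξ / 2 : ℝ) : ℂ)))) f g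

/-- `G n` is the `n`-fold iterate `𝒟^{α,θ} ⋯ 𝒟^{α,θ} f`, all of these being integrable. -/
def IsRieszFellerIterates (α θ : ℝ) (f : ℝ → ℝ) (G : ℕ → ℝ → ℝ) : Prop :=
  G 0 = f ∧ ∀ n, IsRieszFeller α θ (G n) (G (n + 1))

/-- `g = 𝒪_c^{α,θ} f`, the fractional shift (exponential) operator
`∑ n, (c ^ n / n!) 𝒟^{α,θ} ⋯ 𝒟^{α,θ} f` (`n` factors in the `n`-th term), the series being summed
on the side of the Fourier transforms. In other words `g̃(ξ) = e^{-c ψ_{α,θ}(ξ)} f̃(ξ)`. -/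
def IsFractionalShift (α θ c : ℝ) (f g : ℝ → ℝ) : Prop :=
  ∃ G : ℕ → ℝ → ℝ, IsRieszFellerIterates α θ f G ∧ Integrable g ∧ Continuous g ∧
    ∀ ξ : ℝ, HasSum (fun n : ℕ => ((c ^ n / (n.factorial : ℝ) : ℝ) : ℂ) * fourierPos (G n) ξ)
      (fourierPos g ξ)

/-- The series `∑ n, (c ^ n / n!) 𝒟^{α,θ} ⋯ 𝒟^{α,θ} f` converges to `g` uniformly on the line. -/
def IsUniformFractionalShift (α θ c : ℝ) (f g : ℝ → ℝ) : Prop :=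
  ∃ G : ℕ → ℝ → ℝ, IsRieszFellerIterates α θ f G ∧
    TendstoUniformly
      (fun (N : ℕ) (x : ℝ) => ∑ n ∈ Finset.range N, c ^ n / (n.factorial : ℝ) * G n x) g atTop

/-- `g = e^{∂ₓ²} f`: `f` is smooth, its derivatives of even order are integrable, and
`∑ n, (1 / n!) ∂ₓ^{2n} f` converges to `g` uniformly on the line. -/
structure IsExpSecondDeriv (f g : ℝ → ℝ) : Prop where
  smooth : ContDiff ℝ (⊤ : ℕ∞) f
  integrable : ∀ n : ℕ, Integrable (iteratedDeriv (2 * n) f)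
  tendsto : TendstoUniformly
    (fun (N : ℕ) (x : ℝ) =>
      ∑ n ∈ Finset.range N, iteratedDeriv (2 * n) f x / (n.factorial : ℝ)) g atTop

/-! ### Processes -/

/-- `f` is the (unique) continuous density of the measure `ν` on the line. -/
structure IsContinuousDensity (ν : Measure ℝ) (f : ℝ → ℝ) : Prop where
  continuous : Continuous f
  nonneg : ∀ x, 0 ≤ f x
  eq_withDensity : ν = volume.withDensity (fun x => ENNReal.ofReal (f x))

/-- The `α`-stable process `𝒮_α^θ`: it starts at `0` and has independent and stationary
increments, with `E e^{iξ (S(t) - S(s))} = e^{-(t - s) ψ_{α,θ}(ξ)}`. -/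
structure IsStableProcess {Ω : Type*} [MeasurableSpace Ω] (α θ : ℝ) (S : ℝ≥0 → Ω → ℝ)
    (μ : Measure Ω) : Prop where
  measurable : ∀ t, Measurable (S t)
  zero : ∀ᵐ ω ∂μ, S 0 ω = 0
  indep : HasIndepIncrements S μ
  charFun_increment : ∀ s t : ℝ≥0, s ≤ t → ∀ ξ : ℝ,
    charFun (μ.map (fun ω => S t ω - S s ω)) ξ
      = Complex.exp (-(((t : ℝ) - (s : ℝ) : ℝ) : ℂ) * psiSymbol α θ ξ)

/-- The linear birth (Yule-Furry) process with one progenitor and rate `rate`: it starts at `1`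
and increases by unit jumps; the successive holding times `T 0, T 1, …` are independent, and that
in the state `n + 1` is exponential with parameter `rate * (n + 1)`. The state at time `t` exceeds
`n` if and only if the first `n` births have taken place by time `t`. -/
structure IsYuleProcess {Ω : Type*} [MeasurableSpace Ω] (rate : ℝ) (B : ℝ≥0 → Ω → ℕ)
    (μ : Measure Ω) : Prop where
  measurable : ∀ t, Measurable (B t)
  holding : ∃ T : ℕ → Ω → ℝ, (∀ n, Measurable (T n)) ∧ iIndepFun T μ ∧
    (∀ n : ℕ, μ.map (T n) = expMeasure (rate * (n + 1))) ∧
    ∀ᵐ ω ∂μ, ∀ (t : ℝ≥0) (n : ℕ), n < B t ω ↔ ∑ i ∈ Finset.range n, T i ω ≤ (t : ℝ)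

/-! Let `ψ` be the symbol with `θ = 2 - α` and `q = e^{-λt}`. At time `t` the Yule process is
geometric with parameter `q`, so averaging `e^{-(at+k)ψ}` over its law gives the characteristic
function `φ = q e^{-(1+at)ψ} / (1 - (1-q) e^{-ψ})` (`charFun_subordinated`). As a function of `t`
and `ψ` it satisfies a first-order equation, namely the Kolmogorov equation for the generating
function of the birth process written in the variable `-log z`: `∂_t φ = a (-ψ φ + λ t (1 - e^{-ψ})
φ) + λ (1 - e^{-ψ}) ∂_ψ φ` (`hasDerivAt_yuleStable_time`).

Inverting the Fourier transform gives the theorem. Multiplication by `-ψ` is the Riesz-Feller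
derivative and by `e^{-ψ}` the shift. For the last term, `φ' = ψ' ∂_ψ φ` in the frequency, while
`φ'` is `i` times the transform of `x u`; hence `∂_ψ φ` is the transform of `x u` times `i / ψ'`,
which is `1/α` times the Feller symbol (`isFellerIntegral_mul_density`). The phase of `i / ψ'`
corresponds to `γ = θ - 1`, which is admissible for order `α - 1` only when `θ = 2 - α`.

The analysis rests on three points. Since `cos((2-α)π/2) > 0` and the denominator is at least `q` in
modulus, `φ`, `∂_ψ φ` and their frequency derivatives decay exponentially; by Plancherel their
inverse transforms are integrable (`integrable_fourier_of_deriv`), so inversion is legitimate.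
Integrability of `x u` comes from `1 - φ = O(|ξ|^α)` with `α > 1`, through a tail bound
(`integrable_id_of_charFun`). Uniform convergence of the operator series comes from the remainder
bound `|w|^N / N!` for `e^{-w}`, `Re w ≥ 0`: against `e^{-|ξ|^α}` it integrates to a multiple of
`Γ(N + 1/α) / N!`, which tends to `0` (`tendstoUniformly_exp_series`). The condition `(1+at)
cos(πθ/2) ≥ 1` provides exactly this weight. -/

/-! ### Integrability of Fourier transforms through Plancherel -/

section Plancherel
open FourierTransform

/-- The Fourier transform of a function in `L¹ ∩ L²` lies in `L²`. -/
theorem memLp_two_fourier {g : ℝ → ℂ} (hg : Integrable g) (hg2 : MemLp g 2) :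
    MemLp (𝓕 g) 2 := by
  set h : Lp ℂ 2 (volume : Measure ℝ) := 𝓕 (hg2.toLp g) with hh
  have hcont : Continuous (𝓕 g) :=
    VectorFourier.fourierIntegral_continuous Real.continuous_fourierChar
      (by exact continuous_inner) hg
  -- The `L²` transform is known only as a tempered distribution; testing against smooth compactly
  -- supported functions and moving the transform onto them by Fubini identifies it with the
  -- integral.
  have key : ∀ᵐ x, (𝓕 g) x = h x := by
    refine ae_eq_of_integral_contDiff_smul_eq hcont.locallyIntegrable
      ((Lp.memLp h).locallyIntegrable (by norm_num)) fun φ φ_smooth φ_cpt => ?_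
    have h₁ : HasCompactSupport (Complex.ofRealCLM ∘ φ) := φ_cpt.comp_left rfl
    have h₂ : ContDiff ℝ ((⊤ : ℕ∞) : WithTop ℕ∞) (Complex.ofRealCLM ∘ φ) :=
      Complex.ofRealCLM.contDiff.comp φ_smooth
    set Φ := h₁.toSchwartzMap h₂
    have e1 := congrArg (fun T => T Φ)
      (Lp.fourier_toTemperedDistribution_eq (E := ℝ) (F := ℂ) (hg2.toLp g))
    simp only [TemperedDistribution.fourier_apply, Lp.toTemperedDistribution_apply] at e1
    have e2 := VectorFourier.integral_fourierIntegral_smul_eq_flip (L := innerₗ ℝ)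
      (μ := volume) (ν := volume)
      Real.continuous_fourierChar (by exact continuous_inner) Φ.integrable hg
    have e3 : ∫ x, (𝓕 Φ) x • (hg2.toLp g) x = ∫ x, (𝓕 (Φ : ℝ → ℂ)) x • g x := by
      refine integral_congr_ae ?_
      filter_upwards [hg2.coeFn_toLp] with x hx
      rw [hx, SchwartzMap.fourier_coe]
    rw [e3] at e1
    have e4 : ∀ x, φ x • 𝓕 g x = Φ x • 𝓕 g x := fun x => by simp [Φ]
    have e5 : ∀ x, φ x • h x = Φ x • h x := fun x => by simp [Φ]
    simp_rw [e4, e5]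
    rw [← e1]
    refine Eq.trans ?_ e2.symm
    congr 1 with x
    congr 1
    rw [flip_innerₗ]
    rfl
  exact (memLp_congr_ae key).mpr (Lp.memLp h)

/-- The Fourier transform of a function in the Sobolev space `H¹` is integrable. -/
theorem integrable_fourier_of_deriv {g : ℝ → ℂ} (hd : Differentiable ℝ g)
    (hg : Integrable g) (hg2 : MemLp g 2) (hg' : Integrable (deriv g))
    (hg2' : MemLp (deriv g) 2) : Integrable (𝓕 g) := by
  have hcont : Continuous (𝓕 g) :=
    VectorFourier.fourierIntegral_continuous Real.continuous_fourierChar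
      (by exact continuous_inner) hg
  have h1 := (memLp_two_fourier hg hg2).integrable_norm_pow (by norm_num)
  have h2 := (memLp_two_fourier hg' hg2').integrable_norm_pow (by norm_num)
  rw [Real.fourier_deriv hg hd hg'] at h2
  refine ((integrable_inv_one_add_sq.add (h1.add h2))).mono' hcont.aestronglyMeasurable
    (ae_of_all _ fun x => ?_)
  have hπ : (1:ℝ) ≤ (2 * Real.pi) ^ 2 := by nlinarith [Real.pi_gt_three]
  have e : ‖(2 * Real.pi * Complex.I * x : ℂ) • 𝓕 g x‖ ^ 2
      = (2 * Real.pi) ^ 2 * (x ^ 2 * ‖𝓕 g x‖ ^ 2) := by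
    rw [norm_smul]
    simp [mul_pow]
    ring
  simp only [Pi.add_apply]
  norm_num
  set n := ‖𝓕 g x‖
  norm_num at e
  rw [e]
  have h3 : x ^ 2 * n ^ 2 ≤ (2 * Real.pi) ^ 2 * (x ^ 2 * n ^ 2) :=
    le_mul_of_one_le_left (by positivity) hπ
  have h4 : 0 < 1 + x ^ 2 := by positivity
  -- AM-GM, in place of Cauchy-Schwarz: both terms on the right are integrable.
  have h5 : n ≤ (1 + x ^ 2)⁻¹ + (1 + x ^ 2) * n ^ 2 := by
    have : (1 + x ^ 2)⁻¹ * (1 + x ^ 2) = 1 := inv_mul_cancel₀ h4.ne'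
    have h6 : 0 < (1 + x ^ 2)⁻¹ := by positivity
    nlinarith [mul_nonneg h6.le (sq_nonneg (1 - (1 + x ^ 2) * n)), norm_nonneg (𝓕 g x),
      mul_nonneg h4.le (sq_nonneg n)]
  nlinarith

end Plancherel

/-! ### Symbols with exponential decay and multipliers -/

/-- Hermitian differentiable functions which decay exponentially, together with their
derivatives. -/
structure ExpDecay (g : ℝ → ℂ) : Prop where
  conj : ∀ ξ, g (-ξ) = starRingEnd ℂ (g ξ)
  differentiable : Differentiable ℝ g
  bound : ∃ C δ : ℝ, 0 < δ ∧ ∀ ξ, ‖g ξ‖ ≤ C * Real.exp (-δ * |ξ|) ∧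
    ‖deriv g ξ‖ ≤ C * Real.exp (-δ * |ξ|)

/-- Hermitian differentiable functions of polynomial growth, together with their derivatives. -/
structure PolyGrowth (m : ℝ → ℂ) : Prop where
  conj : ∀ ξ, m (-ξ) = starRingEnd ℂ (m ξ)
  differentiable : Differentiable ℝ m
  bound : ∃ (K : ℝ) (n : ℕ), ∀ ξ, ‖m ξ‖ ≤ K * (1 + |ξ|) ^ n ∧ ‖deriv m ξ‖ ≤ K * (1 + |ξ|) ^ n

/-- Half of the exponential rate is spent on the polynomial, using `y ^ n / n! ≤ e^y` at `y =
(δ/2)(1 + |ξ|)`. -/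
theorem one_add_abs_pow_mul_exp_le {δ : ℝ} (hδ : 0 < δ) (n : ℕ) :
    ∃ C : ℝ, 0 ≤ C ∧ ∀ ξ : ℝ,
      (1 + |ξ|) ^ n * Real.exp (-δ * |ξ|) ≤ C * Real.exp (-(δ / 2) * |ξ|) := by
  refine ⟨n.factorial * (2 / δ) ^ n * Real.exp (δ / 2), by positivity, fun ξ => ?_⟩
  have h := Real.pow_div_factorial_le_exp (x := δ / 2 * (1 + |ξ|)) (by positivity) n
  rw [div_le_iff₀ (by positivity), mul_pow] at h
  have h2 : (1 + |ξ|) ^ n ≤ (2 / δ) ^ n * (Real.exp (δ / 2 * (1 + |ξ|)) * n.factorial) := by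
    calc (1 + |ξ|) ^ n = (2 / δ) ^ n * ((δ / 2) ^ n * (1 + |ξ|) ^ n) := by
          rw [← mul_assoc, ← mul_pow, div_mul_div_cancel₀ (by positivity), div_self (by positivity)]
          simp
      _ ≤ _ := by gcongr
  calc (1 + |ξ|) ^ n * Real.exp (-δ * |ξ|)
      ≤ (2 / δ) ^ n * (Real.exp (δ / 2 * (1 + |ξ|)) * n.factorial) * Real.exp (-δ * |ξ|) := by
        gcongr
    _ = n.factorial * (2 / δ) ^ n * (Real.exp (δ / 2 * (1 + |ξ|)) * Real.exp (-δ * |ξ|)) := by ring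
    _ = n.factorial * (2 / δ) ^ n * (Real.exp (δ / 2) * Real.exp (-(δ / 2) * |ξ|)) := by
        rw [← Real.exp_add, ← Real.exp_add]; ring_nf
    _ = _ := by ring

theorem integrable_exp_neg_mul_abs {δ : ℝ} (hδ : 0 < δ) :
    Integrable (fun ξ : ℝ => Real.exp (-δ * |ξ|)) := by
  obtain ⟨C, hC0, hC⟩ := one_add_abs_pow_mul_exp_le (δ := δ) hδ 2
  refine (integrable_inv_one_add_sq.const_mul C).mono' (by fun_prop) (ae_of_all _ fun ξ => ?_)
  rw [Real.norm_of_nonneg (by positivity), ← div_eq_mul_inv, le_div_iff₀ (by positivity)]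
  have h := hC ξ
  have h1 : Real.exp (-(δ / 2) * |ξ|) ≤ 1 := Real.exp_le_one_iff.mpr (by nlinarith [abs_nonneg ξ])
  have h2 : 1 + ξ ^ 2 ≤ (1 + |ξ|) ^ 2 := by nlinarith [abs_nonneg ξ, sq_abs ξ]
  nlinarith [Real.exp_pos (-δ * |ξ|)]

namespace PolyGrowth

theorem const (c : ℝ) : PolyGrowth (fun _ => (c : ℂ)) where
  conj _ := by simp
  differentiable := by fun_prop
  bound := ⟨|c|, 0, fun ξ => by simp⟩

theorem mul {m₁ m₂ : ℝ → ℂ} (h₁ : PolyGrowth m₁) (h₂ : PolyGrowth m₂) :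
    PolyGrowth (fun ξ => m₁ ξ * m₂ ξ) where
  conj ξ := by simp [h₁.conj, h₂.conj]
  differentiable := h₁.differentiable.mul h₂.differentiable
  bound := by
    obtain ⟨K₁, n₁, hb₁⟩ := h₁.bound
    obtain ⟨K₂, n₂, hb₂⟩ := h₂.bound
    refine ⟨2 * (K₁ * K₂), n₁ + n₂, fun ξ => ?_⟩
    obtain ⟨a₁, b₁⟩ := hb₁ ξ
    obtain ⟨a₂, b₂⟩ := hb₂ ξ
    have e : K₁ * K₂ * (1 + |ξ|) ^ (n₁ + n₂)
      = (K₁ * (1 + |ξ|) ^ n₁) * (K₂ * (1 + |ξ|) ^ n₂) := by ring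
    have p1 := (norm_nonneg _).trans a₁
    have p2 := (norm_nonneg _).trans a₂
    rw [mul_assoc, e]
    constructor
    · rw [norm_mul]
      nlinarith [mul_le_mul a₁ a₂ (norm_nonneg _) p1, mul_nonneg p1 p2]
    · have hd : deriv (fun ξ => m₁ ξ * m₂ ξ) ξ = deriv m₁ ξ * m₂ ξ + m₁ ξ * deriv m₂ ξ :=
        deriv_fun_mul (h₁.differentiable ξ) (h₂.differentiable ξ)
      rw [hd]
      refine (norm_add_le _ _).trans ?_
      rw [norm_mul, norm_mul]
      nlinarith [mul_le_mul b₁ a₂ (norm_nonneg _) p1, mul_le_mul a₁ b₂ (norm_nonneg _) p1]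

theorem add {m₁ m₂ : ℝ → ℂ} (h₁ : PolyGrowth m₁) (h₂ : PolyGrowth m₂) :
    PolyGrowth (fun ξ => m₁ ξ + m₂ ξ) where
  conj ξ := by simp [h₁.conj, h₂.conj]
  differentiable := h₁.differentiable.add h₂.differentiable
  bound := by
    obtain ⟨K₁, n₁, hb₁⟩ := h₁.bound
    obtain ⟨K₂, n₂, hb₂⟩ := h₂.bound
    have k1 : 0 ≤ K₁ := by simpa using (norm_nonneg _).trans (hb₁ 0).1
    have k2 : 0 ≤ K₂ := by simpa using (norm_nonneg _).trans (hb₂ 0).1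
    refine ⟨K₁ + K₂, n₁ + n₂, fun ξ => ?_⟩
    obtain ⟨a₁, b₁⟩ := hb₁ ξ
    obtain ⟨a₂, b₂⟩ := hb₂ ξ
    have o : 1 ≤ 1 + |ξ| := by linarith [abs_nonneg ξ]
    have e1 : K₁ * (1 + |ξ|) ^ n₁ ≤ K₁ * (1 + |ξ|) ^ (n₁ + n₂) := by gcongr; all_goals omega
    have e2 : K₂ * (1 + |ξ|) ^ n₂ ≤ K₂ * (1 + |ξ|) ^ (n₁ + n₂) := by gcongr; all_goals omega
    rw [add_mul]
    constructor
    · exact (norm_add_le _ _).trans (by linarith)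
    · have hd : deriv (fun ξ => m₁ ξ + m₂ ξ) ξ = deriv m₁ ξ + deriv m₂ ξ :=
        deriv_fun_add (h₁.differentiable ξ) (h₂.differentiable ξ)
      rw [hd]
      exact (norm_add_le _ _).trans (by linarith)

theorem const_mul {m : ℝ → ℂ} (h : PolyGrowth m) (c : ℝ) : PolyGrowth (fun ξ => (c : ℂ) * m ξ) :=
  (const c).mul h

theorem neg {m : ℝ → ℂ} (h : PolyGrowth m) : PolyGrowth (fun ξ => -m ξ) := by
  simpa using h.const_mul (-1)

theorem pow {m : ℝ → ℂ} (h : PolyGrowth m) (n : ℕ) : PolyGrowth (fun ξ => m ξ ^ n) := by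
  induction n with
  | zero => simpa using const 1
  | succ n ih => simpa only [pow_succ] using ih.mul h

theorem inv {m : ℝ → ℂ} (h : PolyGrowth m) {κ : ℝ} (hκ : 0 < κ) (hm : ∀ ξ, κ ≤ ‖m ξ‖) :
    PolyGrowth (fun ξ => (m ξ)⁻¹) where
  conj ξ := by simp [h.conj]
  differentiable ξ := (h.differentiable ξ).inv (norm_pos_iff.mp (hκ.trans_le (hm ξ)))
  bound := by
    obtain ⟨K, n, hb⟩ := h.bound
    have k0 : 0 ≤ K := by simpa using (norm_nonneg _).trans (hb 0).1
    refine ⟨κ⁻¹ + K / κ ^ 2, n, fun ξ => ?_⟩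
    have o : 1 ≤ (1 + |ξ|) ^ n := one_le_pow₀ (by linarith [abs_nonneg ξ])
    have i0 : ‖m ξ‖⁻¹ ≤ κ⁻¹ := inv_anti₀ hκ (hm ξ)
    have hm0 : m ξ ≠ 0 := norm_pos_iff.mp (hκ.trans_le (hm ξ))
    have hp : 0 ≤ K / κ ^ 2 * (1 + |ξ|) ^ n := by positivity
    have hq : 0 < κ⁻¹ := by positivity
    constructor
    · rw [norm_inv]
      nlinarith
    · have hd : deriv (fun ξ => (m ξ)⁻¹) ξ = -deriv m ξ / m ξ ^ 2 :=
        ((h.differentiable ξ).hasDerivAt.inv hm0).deriv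
      rw [hd, norm_div, norm_neg, norm_pow]
      calc ‖deriv m ξ‖ / ‖m ξ‖ ^ 2 ≤ K * (1 + |ξ|) ^ n / κ ^ 2 := by
            gcongr
            · exact (hb ξ).2
            · exact hm ξ
        _ = K / κ ^ 2 * (1 + |ξ|) ^ n := by ring
        _ ≤ _ := by nlinarith

theorem neg_I_mul : PolyGrowth (fun ξ => -Complex.I * ξ) where
  conj ξ := by simp
  differentiable := by fun_prop
  bound := by
    refine ⟨1, 1, fun ξ => ⟨by simp, ?_⟩⟩
    have hd : deriv (fun ξ : ℝ => -Complex.I * (ξ : ℂ)) ξ = -Complex.I := by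
      simpa using (Complex.ofRealCLM.hasDerivAt (x := ξ).const_mul (-Complex.I)).deriv
    rw [hd]
    simp

end PolyGrowth

namespace ExpDecay

variable {g : ℝ → ℂ}

/-- This closure property lets the operators be applied repeatedly without leaving the class on
which inversion holds. -/
theorem mul {m : ℝ → ℂ} (hm : PolyGrowth m) (hg : ExpDecay g) : ExpDecay (fun ξ => m ξ * g ξ) where
  conj ξ := by simp [hm.conj, hg.conj]
  differentiable := hm.differentiable.mul hg.differentiable
  bound := by
    obtain ⟨K, n, hb₁⟩ := hm.bound
    obtain ⟨C, δ, hδ, hb₂⟩ := hg.bound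
    obtain ⟨A, hA, hb₃⟩ := one_add_abs_pow_mul_exp_le hδ n
    have k1 : 0 ≤ K := by simpa using (norm_nonneg _).trans (hb₁ 0).1
    have k2 : 0 ≤ C := by simpa using (norm_nonneg _).trans (hb₂ 0).1
    refine ⟨2 * (K * C * A), δ / 2, by positivity, fun ξ => ?_⟩
    obtain ⟨a₁, b₁⟩ := hb₁ ξ
    obtain ⟨a₂, b₂⟩ := hb₂ ξ
    have p1 := (norm_nonneg _).trans a₁
    have p2 := (norm_nonneg _).trans a₂
    have e : (K * (1 + |ξ|) ^ n) * (C * Real.exp (-δ * |ξ|))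
        ≤ K * C * A * Real.exp (-(δ / 2) * |ξ|) := by
      calc _ = K * C * ((1 + |ξ|) ^ n * Real.exp (-δ * |ξ|)) := by ring
        _ ≤ K * C * (A * Real.exp (-(δ / 2) * |ξ|)) :=
          mul_le_mul_of_nonneg_left (hb₃ ξ) (by positivity)
        _ = _ := by ring
    rw [mul_assoc]
    constructor
    · rw [norm_mul]
      nlinarith [mul_le_mul a₁ a₂ (norm_nonneg _) p1, mul_nonneg p1 p2]
    · have hd : deriv (fun ξ => m ξ * g ξ) ξ = deriv m ξ * g ξ + m ξ * deriv g ξ :=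
        deriv_fun_mul (hm.differentiable ξ) (hg.differentiable ξ)
      rw [hd]
      refine (norm_add_le _ _).trans ?_
      rw [norm_mul, norm_mul]
      nlinarith [mul_le_mul b₁ a₂ (norm_nonneg _) p1, mul_le_mul a₁ b₂ (norm_nonneg _) p1]

theorem integrable (hg : ExpDecay g) : Integrable g := by
  obtain ⟨C, δ, hδ, hb⟩ := hg.bound
  exact ((integrable_exp_neg_mul_abs hδ).const_mul C).mono'
    hg.differentiable.continuous.aestronglyMeasurable (ae_of_all _ fun ξ => (hb ξ).1)

theorem integrable_deriv (hg : ExpDecay g) : Integrable (deriv g) := by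
  obtain ⟨C, δ, hδ, hb⟩ := hg.bound
  exact ((integrable_exp_neg_mul_abs hδ).const_mul C).mono'
    (measurable_deriv g).aestronglyMeasurable (ae_of_all _ fun ξ => (hb ξ).2)

theorem memLp_two_of_exp_bound {f : ℝ → ℂ} (hf : AEStronglyMeasurable f) {C δ : ℝ} (hδ : 0 < δ)
    (hb : ∀ ξ, ‖f ξ‖ ≤ C * Real.exp (-δ * |ξ|)) : MemLp f 2 := by
  rw [memLp_two_iff_integrable_sq_norm hf]
  refine ((integrable_exp_neg_mul_abs (δ := 2 * δ) (by positivity)).const_mul (C ^ 2)).mono'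
    (by fun_prop) (ae_of_all _ fun ξ => ?_)
  have e : C ^ 2 * Real.exp (-(2 * δ) * |ξ|) = (C * Real.exp (-δ * |ξ|)) ^ 2 := by
    rw [mul_pow, ← Real.exp_nat_mul]; ring_nf
  rw [e, Real.norm_of_nonneg (by positivity)]
  gcongr
  exact hb ξ

open FourierTransform in
theorem integrable_fourier (hg : ExpDecay g) : Integrable (𝓕 g) := by
  obtain ⟨C, δ, hδ, hb⟩ := hg.bound
  exact integrable_fourier_of_deriv hg.differentiable hg.integrable
    (memLp_two_of_exp_bound hg.differentiable.continuous.aestronglyMeasurable hδ fun ξ => (hb ξ).1)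
    hg.integrable_deriv
    (memLp_two_of_exp_bound (measurable_deriv g).aestronglyMeasurable hδ fun ξ => (hb ξ).2)

end ExpDecay

/-! ### The inverse Fourier transform -/

/-- The inverse of the Fourier transform `fourierPos`, on Hermitian functions. -/
noncomputable def invFourierPos (g : ℝ → ℂ) (x : ℝ) : ℝ :=
  ((2 * Real.pi : ℂ)⁻¹ * ∫ ξ : ℝ, Complex.exp (-(Complex.I * ξ * x)) * g ξ).re

theorem integrable_exp_mul {g : ℝ → ℂ} (hg : Integrable g) (x : ℝ) :
    Integrable (fun ξ : ℝ => Complex.exp (-(Complex.I * ξ * x)) * g ξ) := by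
  refine hg.norm.mono' ((by fun_prop : Continuous fun ξ : ℝ =>
    Complex.exp (-(Complex.I * ξ * x))).aestronglyMeasurable.mul hg.1) (ae_of_all _ fun ξ => ?_)
  simp [Complex.norm_exp]

theorem invFourierPos_sub {g h : ℝ → ℂ} (hg : Integrable g) (hh : Integrable h) (x : ℝ) :
    invFourierPos (fun ξ => g ξ - h ξ) x = invFourierPos g x - invFourierPos h x := by
  simp only [invFourierPos, mul_sub]
  rw [integral_sub (integrable_exp_mul hg x) (integrable_exp_mul hh x), mul_sub, Complex.sub_re]

theorem invFourierPos_add {g h : ℝ → ℂ} (hg : Integrable g) (hh : Integrable h) (x : ℝ) :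
    invFourierPos (fun ξ => g ξ + h ξ) x = invFourierPos g x + invFourierPos h x := by
  simp only [invFourierPos, mul_add]
  rw [integral_add (integrable_exp_mul hg x) (integrable_exp_mul hh x), mul_add, Complex.add_re]

theorem invFourierPos_const_mul (c : ℝ) (g : ℝ → ℂ) (x : ℝ) :
    invFourierPos (fun ξ => c * g ξ) x = c * invFourierPos g x := by
  simp only [invFourierPos, mul_left_comm _ (c : ℂ)]
  rw [integral_const_mul, mul_left_comm, Complex.re_ofReal_mul]

theorem invFourierPos_zero (x : ℝ) : invFourierPos (fun _ => 0) x = 0 := by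
  simp [invFourierPos]

theorem abs_invFourierPos_le {g : ℝ → ℂ} (x : ℝ) :
    |invFourierPos g x| ≤ ∫ ξ, ‖g ξ‖ := by
  refine (Complex.abs_re_le_norm _).trans ?_
  rw [norm_mul]
  have h1 : ‖(2 * Real.pi : ℂ)⁻¹‖ ≤ 1 := by
    rw [norm_inv]
    refine inv_le_one_of_one_le₀ ?_
    simp only [norm_mul, Complex.norm_ofNat, Complex.norm_real, Real.norm_of_nonneg Real.pi_pos.le]
    linarith [Real.pi_gt_three]
  refine (mul_le_of_le_one_left (norm_nonneg _) h1).trans ?_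
  refine (norm_integral_le_integral_norm _).trans (le_of_eq ?_)
  congr 1 with ξ
  simp [Complex.norm_exp]

theorem invFourierPos_sum {ι : Type*} (s : Finset ι) (c : ι → ℝ) (g : ι → ℝ → ℂ)
    (hg : ∀ i, Integrable (g i)) (x : ℝ) :
    invFourierPos (fun ξ => ∑ i ∈ s, c i * g i ξ) x = ∑ i ∈ s, c i * invFourierPos (g i) x := by
  classical
  induction s using Finset.induction_on with
  | empty => simp [invFourierPos_zero]
  | insert i s hi ih =>
    simp only [Finset.sum_insert hi]
    rw [invFourierPos_add ((hg i).const_mul _)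
      (integrable_finsetSum _ fun j _ => (hg j).const_mul _), ih, invFourierPos_const_mul]

namespace ExpDecay
variable {g : ℝ → ℂ}

/-- Hermitian symmetry makes the inversion integral real, so taking the real part loses nothing. -/
theorem ofReal_invFourierPos (hg : ∀ ξ, g (-ξ) = starRingEnd ℂ (g ξ)) (x : ℝ) :
    (invFourierPos g x : ℂ)
      = (2 * Real.pi : ℂ)⁻¹ * ∫ ξ : ℝ, Complex.exp (-(Complex.I * ξ * x)) * g ξ := by
  rw [invFourierPos]
  refine Complex.conj_eq_iff_re.mp ?_
  rw [map_mul, ← integral_conj]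
  congr 1
  · simp [Complex.conj_ofNat]
  · rw [← integral_neg_eq_self]
    congr 1 with ξ
    simp [hg, ← Complex.exp_conj]

open FourierTransform

theorem ofReal_invFourierPos' (hg : ∀ ξ, g (-ξ) = starRingEnd ℂ (g ξ)) (x : ℝ) :
    (invFourierPos g x : ℂ) = (2 * Real.pi : ℂ)⁻¹ * 𝓕 g (x / (2 * Real.pi)) := by
  rw [ofReal_invFourierPos hg, Real.fourier_eq']
  congr 2 with ξ
  rw [smul_eq_mul]
  congr 2
  have : (Real.pi : ℂ) ≠ 0 := by exact_mod_cast Real.pi_ne_zero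
  simp
  field_simp

theorem fourierPos_eq_fourierInv (f : ℝ → ℝ) (ξ : ℝ) :
    fourierPos f ξ = 𝓕⁻ (fun x => (f x : ℂ)) (ξ / (2 * Real.pi)) := by
  rw [fourierPos, Real.fourierInv_eq']
  congr 1 with x
  rw [smul_eq_mul]
  congr 2
  have : (Real.pi : ℂ) ≠ 0 := by exact_mod_cast Real.pi_ne_zero
  simp
  field_simp

theorem continuous_invFourierPos (hg : ExpDecay g) : Continuous (invFourierPos g) := by
  have hcont : Continuous (𝓕 g) :=
    VectorFourier.fourierIntegral_continuous Real.continuous_fourierChar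
      (by exact continuous_inner) hg.integrable
  have : invFourierPos g
      = fun x => ((2 * Real.pi : ℂ)⁻¹ * 𝓕 g (x / (2 * Real.pi))).re := by
    ext x
    rw [← ofReal_invFourierPos' hg.conj, Complex.ofReal_re]
  rw [this]
  fun_prop

theorem integrable_invFourierPos (hg : ExpDecay g) : Integrable (invFourierPos g) := by
  have := ((hg.integrable_fourier.comp_div
    (show (2 * Real.pi) ≠ 0 by positivity)).const_mul (2 * Real.pi : ℂ)⁻¹).re
  refine this.congr (ae_of_all _ fun x => ?_)
  simp only [← ofReal_invFourierPos' hg.conj]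
  simp

theorem fourierPos_invFourierPos (hg : ExpDecay g) (ξ : ℝ) :
    fourierPos (invFourierPos g) ξ = g ξ := by
  have h := congrFun (hg.differentiable.continuous.fourierInv_fourier_eq hg.integrable
    hg.integrable_fourier) ξ
  rw [Real.fourierInv_eq'] at h
  rw [fourierPos, ← h]
  have hpi : (Real.pi : ℂ) ≠ 0 := by exact_mod_cast Real.pi_ne_zero
  have e : ∀ x : ℝ, Complex.exp (Complex.I * ξ * x) * (invFourierPos g x : ℂ)
      = (fun y : ℝ => (2 * Real.pi : ℂ)⁻¹ * (Complex.exp (↑(2 * Real.pi * inner ℝ y ξ) * Complex.I)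
        • 𝓕 g y)) (x / (2 * Real.pi)) := fun x => by
    rw [ofReal_invFourierPos' hg.conj]
    simp only [smul_eq_mul]
    rw [mul_left_comm]
    congr 3
    simp
    field_simp
  simp_rw [e]
  -- The substitution `x = 2π y` produces the factor that cancels `(2π)⁻¹`.
  rw [Measure.integral_comp_div (fun y : ℝ => (2 * Real.pi : ℂ)⁻¹ *
    (Complex.exp (↑(2 * Real.pi * inner ℝ y ξ) * Complex.I) • 𝓕 g y)),
    integral_const_mul, abs_of_pos (by positivity)]
  rw [Complex.real_smul]
  push_cast
  field_simp
  refine integral_congr_ae (ae_of_all _ fun y => ?_)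
  dsimp only
  congr 2
  ring

theorem isFourierMultiplier (hg : ExpDecay g) {m : ℝ → ℂ} (hm : PolyGrowth m) :
    IsFourierMultiplier m (invFourierPos g) (invFourierPos fun ξ => m ξ * g ξ) where
  integrable_left := hg.integrable_invFourierPos
  integrable_right := (hg.mul hm).integrable_invFourierPos
  continuous_right := (hg.mul hm).continuous_invFourierPos
  fourier_eq ξ _ := by
    rw [hg.fourierPos_invFourierPos, (hg.mul hm).fourierPos_invFourierPos]

theorem hasDerivAt_invFourierPos (hg : ExpDecay g) (x : ℝ) :
    HasDerivAt (invFourierPos g) (invFourierPos (fun ξ => -Complex.I * ξ * g ξ) x) x := by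
  have h := (hasDerivAt_integral_of_dominated_loc_of_deriv_le (μ := volume) (𝕜 := ℝ)
    (F := fun (x : ℝ) (ξ : ℝ) => Complex.exp (-(Complex.I * ξ * x)) * g ξ)
    (F' := fun (x : ℝ) (ξ : ℝ) => Complex.exp (-(Complex.I * ξ * x)) * (-Complex.I * ξ * g ξ))
    (x₀ := x) (s := Set.univ) (bound := fun ξ => ‖-Complex.I * ξ * g ξ‖) univ_mem
    (Eventually.of_forall fun y => (integrable_exp_mul hg.integrable y).1)
    (integrable_exp_mul hg.integrable x)
    (integrable_exp_mul (hg.mul PolyGrowth.neg_I_mul).integrable x).1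
    (ae_of_all _ fun ξ y _ => by
      rw [norm_mul]
      simp [Complex.norm_exp])
    (hg.mul PolyGrowth.neg_I_mul).integrable.norm
    (ae_of_all _ fun ξ y _ => by
      have h1 : HasDerivAt (fun y : ℝ => -(Complex.I * ξ * (y : ℂ))) (-(Complex.I * ξ)) y := by
        simpa using ((Complex.ofRealCLM.hasDerivAt (x := y)).const_mul (Complex.I * ξ)).fun_neg
      refine (h1.cexp.mul_const (g ξ)).congr_deriv ?_
      ring)).2
  have h2 := Complex.reCLM.hasFDerivAt.comp_hasDerivAt x (h.const_mul (2 * Real.pi : ℂ)⁻¹)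
  exact h2

end ExpDecay

/-! ### The symbol `ψ_{α,2-α}` -/

/-- The function `e^{-c ψ_{α,2-α}}`. -/
noncomputable def expPsi (α c ξ : ℝ) : ℂ := Complex.exp (-(c : ℂ) * psiSymbol α (2 - α) ξ)

/-- The derivative of `ψ_{α,2-α}`. -/
noncomputable def psiDeriv (α ξ : ℝ) : ℂ :=
  ((α * |ξ| ^ (α - 2) * ξ : ℝ) : ℂ) *
    Complex.exp (Complex.I * ((Real.sign ξ * (2 - α) * Real.pi / 2 : ℝ) : ℂ))

theorem norm_exp_I_mul (y : ℝ) : ‖Complex.exp (Complex.I * (y : ℂ))‖ = 1 := by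
  rw [mul_comm]; exact Complex.norm_exp_ofReal_mul_I y

theorem norm_psiSymbol (α θ ξ : ℝ) : ‖psiSymbol α θ ξ‖ = |ξ| ^ α := by
  rw [psiSymbol, norm_mul, norm_exp_I_mul, Complex.norm_real, mul_one,
    Real.norm_of_nonneg (by positivity)]

theorem psiSymbol_zero {α : ℝ} (hα : α ≠ 0) (θ : ℝ) : psiSymbol α θ 0 = 0 := by
  simp [psiSymbol, Real.zero_rpow hα]

theorem psiSymbol_neg (α θ ξ : ℝ) : psiSymbol α θ (-ξ) = starRingEnd ℂ (psiSymbol α θ ξ) := by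
  rw [psiSymbol, psiSymbol, map_mul, Complex.conj_ofReal, abs_neg, ← Complex.exp_conj, map_mul,
    Complex.conj_I, Complex.conj_ofReal]
  congr 2
  rw [Real.sign_neg]
  push_cast
  ring

theorem re_psiSymbol {α : ℝ} (hα : α ≠ 0) (θ ξ : ℝ) :
    (psiSymbol α θ ξ).re = |ξ| ^ α * Real.cos (θ * Real.pi / 2) := by
  rw [psiSymbol, Complex.re_ofReal_mul, mul_comm Complex.I, Complex.exp_ofReal_mul_I_re]
  rcases lt_trichotomy ξ 0 with h | h | h
  · rw [Real.sign_of_neg h, ← Real.cos_neg]; congr 2; ring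
  · simp [h, Real.zero_rpow hα]
  · rw [Real.sign_of_pos h]; congr 2; ring

theorem cos_pos_of_index {α : ℝ} (h1 : 1 < α) (h2 : α ≤ 2) :
    0 < Real.cos ((2 - α) * Real.pi / 2) := by
  apply Real.cos_pos_of_mem_Ioo
  constructor <;> nlinarith [Real.pi_pos]

theorem abs_rpow_sub_two_mul {α : ℝ} (h1 : 1 < α) (ξ : ℝ) :
    |(|ξ| ^ (α - 2) * ξ)| = |ξ| ^ (α - 1) := by
  rw [abs_mul, abs_of_nonneg (by positivity)]
  rcases eq_or_ne ξ 0 with rfl | h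
  · simp [Real.zero_rpow (show α - 1 ≠ 0 by linarith)]
  · rw [← Real.rpow_add_one (by positivity)]; congr 1; ring

/-- At `0` the jump of the phase is harmless: the modulus `|ξ|^α` is `o(ξ)` because `α > 1`.
Elsewhere the sign is locally constant. -/
theorem hasDerivAt_psiSymbol {α : ℝ} (h1 : 1 < α) (ξ : ℝ) :
    HasDerivAt (psiSymbol α (2 - α)) (psiDeriv α ξ) ξ := by
  rcases eq_or_ne ξ 0 with rfl | h
  · have e : psiDeriv α 0 = 0 := by simp [psiDeriv]
    rw [e, hasDerivAt_iff_isLittleO]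
    have h0 := (hasDerivAt_abs_rpow 0 h1).isLittleO
    simp only [psiSymbol_zero (show α ≠ 0 by linarith), sub_zero, smul_zero]
    refine Asymptotics.IsLittleO.of_norm_left ?_
    simp_rw [norm_psiSymbol]
    simpa [Real.zero_rpow (show α ≠ 0 by linarith)] using h0
  · have hs : Real.sign =ᶠ[𝓝 ξ] fun _ => Real.sign ξ := by
      rcases lt_or_gt_of_ne h with h | h
      · filter_upwards [gt_mem_nhds h] with y hy
        rw [Real.sign_of_neg hy, Real.sign_of_neg h]
      · filter_upwards [lt_mem_nhds h] with y hy
        rw [Real.sign_of_pos hy, Real.sign_of_pos h]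
    have h0 := ((hasDerivAt_abs_rpow ξ h1).ofReal_comp).mul_const
      (Complex.exp (Complex.I * ((Real.sign ξ * (2 - α) * Real.pi / 2 : ℝ) : ℂ)))
    refine h0.congr_of_eventuallyEq ?_
    filter_upwards [hs] with y hy
    rw [psiSymbol, hy]

theorem norm_psiDeriv {α : ℝ} (h1 : 1 < α) (ξ : ℝ) : ‖psiDeriv α ξ‖ = α * |ξ| ^ (α - 1) := by
  rw [psiDeriv, norm_mul, norm_exp_I_mul, Complex.norm_real, mul_one, Real.norm_eq_abs, mul_assoc,
    abs_mul, abs_rpow_sub_two_mul h1, abs_of_pos (by linarith)]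

theorem abs_rpow_le_one_add_abs_sq {β : ℝ} (h0 : 0 ≤ β) (h2 : β ≤ 2) (ξ : ℝ) :
    |ξ| ^ β ≤ (1 + |ξ|) ^ 2 := by
  have := abs_nonneg ξ
  calc |ξ| ^ β ≤ (1 + |ξ|) ^ β := Real.rpow_le_rpow this (by linarith) h0
    _ ≤ (1 + |ξ|) ^ (2 : ℝ) := Real.rpow_le_rpow_of_exponent_le (by linarith) h2
    _ = _ := by norm_num

theorem abs_sub_one_le_abs_rpow {α : ℝ} (h1 : 1 ≤ α) (ξ : ℝ) : |ξ| - 1 ≤ |ξ| ^ α := by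
  rcases le_total |ξ| 1 with h | h
  · have : 0 ≤ |ξ| ^ α := by positivity
    linarith
  · have := Real.rpow_le_rpow_of_exponent_le h h1
    rw [Real.rpow_one] at this
    linarith

section Index
variable {α : ℝ} (h1 : 1 < α) (h2 : α ≤ 2)
include h1 h2

theorem re_psiSymbol_nonneg (ξ : ℝ) : 0 ≤ (psiSymbol α (2 - α) ξ).re := by
  rw [re_psiSymbol (by linarith)]
  have := cos_pos_of_index h1 h2
  positivity

theorem polyGrowth_psiSymbol : PolyGrowth (psiSymbol α (2 - α)) where
  conj := psiSymbol_neg α _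
  differentiable ξ := (hasDerivAt_psiSymbol h1 ξ).differentiableAt
  bound := by
    refine ⟨2, 2, fun ξ => ?_⟩
    have : 0 ≤ (1 + |ξ|) ^ 2 := by positivity
    rw [(hasDerivAt_psiSymbol h1 ξ).deriv, norm_psiDeriv h1, norm_psiSymbol]
    constructor
    · linarith [abs_rpow_le_one_add_abs_sq (show 0 ≤ α by linarith) h2 ξ]
    · exact mul_le_mul h2 (abs_rpow_le_one_add_abs_sq (by linarith) (by linarith) ξ)
        (by positivity) (by norm_num)

omit h2 in
theorem hasDerivAt_expPsi (c ξ : ℝ) :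
    HasDerivAt (expPsi α c)
      (-(c : ℂ) * psiDeriv α ξ * expPsi α c ξ) ξ := by
  refine (((hasDerivAt_psiSymbol h1 ξ).const_mul (-(c : ℂ))).cexp).congr_deriv ?_
  rw [expPsi]
  ring

omit h2 in
theorem norm_expPsi (c ξ : ℝ) :
    ‖expPsi α c ξ‖
      = Real.exp (-(c * Real.cos ((2 - α) * Real.pi / 2)) * |ξ| ^ α) := by
  rw [expPsi, Complex.norm_exp, ← Complex.ofReal_neg, Complex.re_ofReal_mul,
    re_psiSymbol (by linarith)]
  ring_nf

theorem norm_expPsi_le_one {c : ℝ} (hc : 0 ≤ c) (ξ : ℝ) :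
    ‖expPsi α c ξ‖ ≤ 1 := by
  rw [norm_expPsi h1, Real.exp_le_one_iff]
  have := cos_pos_of_index h1 h2
  have : 0 ≤ c * Real.cos ((2 - α) * Real.pi / 2) * |ξ| ^ α := by positivity
  linarith

theorem polyGrowth_expPsi {c : ℝ} (hc : 0 ≤ c) :
    PolyGrowth (expPsi α c) where
  conj ξ := by simp [expPsi, psiSymbol_neg, ← Complex.exp_conj]
  differentiable ξ := (hasDerivAt_expPsi h1 c ξ).differentiableAt
  bound := by
    obtain ⟨K, n, hb⟩ := (polyGrowth_psiSymbol h1 h2).bound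
    refine ⟨1 + c * K, n, fun ξ => ?_⟩
    have h0 := norm_expPsi_le_one h1 h2 hc ξ
    have o : 1 ≤ (1 + |ξ|) ^ n := one_le_pow₀ (by linarith [abs_nonneg ξ])
    have hK := mul_le_mul_of_nonneg_left (hb ξ).2 hc
    have hK0 := (mul_nonneg hc (norm_nonneg _)).trans hK
    constructor
    · nlinarith
    · rw [(hasDerivAt_expPsi h1 c ξ).deriv, norm_mul, norm_mul, norm_neg,
        Complex.norm_real, Real.norm_of_nonneg hc]
      rw [(hasDerivAt_psiSymbol h1 ξ).deriv] at hK
      refine (mul_le_of_le_one_right (by positivity) h0).trans ?_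
      nlinarith

theorem expDecay_expPsi {c : ℝ} (hc : 0 < c) :
    ExpDecay (expPsi α c) := by
  have hk := cos_pos_of_index h1 h2
  set κ := Real.cos ((2 - α) * Real.pi / 2) with hκ
  obtain ⟨A, hA, hb⟩ := one_add_abs_pow_mul_exp_le (δ := c * κ) (by positivity) 2
  have h0 : ∀ ξ, ‖expPsi α c ξ‖
      ≤ Real.exp (c * κ) * Real.exp (-(c * κ) * |ξ|) := fun ξ => by
    rw [norm_expPsi h1, ← hκ, ← Real.exp_add, Real.exp_le_exp]
    have := mul_le_mul_of_nonneg_left (abs_sub_one_le_abs_rpow h1.le ξ)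
      (show 0 ≤ c * κ by positivity)
    linarith
  have hP := polyGrowth_expPsi h1 h2 hc.le
  refine ⟨hP.conj, hP.differentiable, (1 + c * 2) * (Real.exp (c * κ) * A), c * κ / 2,
    by positivity, fun ξ => ?_⟩
  have h3 := hb ξ
  have h4 : ‖expPsi α c ξ‖ * (1 + |ξ|) ^ 2
      ≤ Real.exp (c * κ) * A * Real.exp (-(c * κ / 2) * |ξ|) := by
    calc _ ≤ Real.exp (c * κ) * Real.exp (-(c * κ) * |ξ|) * (1 + |ξ|) ^ 2 := by
            gcongr; exact h0 ξ
      _ = Real.exp (c * κ) * ((1 + |ξ|) ^ 2 * Real.exp (-(c * κ) * |ξ|)) := by ring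
      _ ≤ Real.exp (c * κ) * (A * Real.exp (-(c * κ / 2) * |ξ|)) :=
          mul_le_mul_of_nonneg_left h3 (by positivity)
      _ = _ := by ring
  have o : 1 ≤ (1 + |ξ|) ^ 2 := one_le_pow₀ (by linarith [abs_nonneg ξ])
  set R := Real.exp (c * κ) * A * Real.exp (-(c * κ / 2) * |ξ|) with hR
  set n := ‖expPsi α c ξ‖ with hn
  have n0 : 0 ≤ n := norm_nonneg _
  have hR0 : 0 ≤ R := by positivity
  rw [mul_assoc, ← hR]
  constructor
  · nlinarith [mul_nonneg hc.le hR0]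
  · rw [(hasDerivAt_expPsi h1 c ξ).deriv, norm_mul, norm_mul, norm_neg,
      Complex.norm_real, Real.norm_of_nonneg hc.le, ← hn]
    have h5 : ‖psiDeriv α ξ‖ ≤ 2 * (1 + |ξ|) ^ 2 := by
      rw [norm_psiDeriv h1]
      exact mul_le_mul h2 (abs_rpow_le_one_add_abs_sq (by linarith) (by linarith) ξ)
        (by positivity) (by norm_num)
    calc c * ‖psiDeriv α ξ‖ * n ≤ c * (2 * (1 + |ξ|) ^ 2) * n := by gcongr
      _ = c * 2 * (n * (1 + |ξ|) ^ 2) := by ring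
      _ ≤ c * 2 * R := mul_le_mul_of_nonneg_left h4 (by positivity)
      _ ≤ (1 + c * 2) * R := by linarith

end Index

/-! ### The characteristic function of the subordinated process -/

/-- The denominator `1 - (1 - e^{-λt}) e^{-ψ}`. -/
noncomputable def yuleDenom (α rate t ξ : ℝ) : ℂ :=
  1 - (1 - (Real.exp (-(rate * t)) : ℂ)) * expPsi α 1 ξ

/-- The characteristic function of `𝒮(at + B(t))`. -/
noncomputable def yuleStable (α a rate t ξ : ℝ) : ℂ :=
  ((Real.exp (-(rate * t)) : ℂ) * (yuleDenom α rate t ξ)⁻¹) * expPsi α (1 + a * t) ξ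

/-- The derivative of `yuleStable` with respect to `ψ`. -/
noncomputable def yuleStableDeriv (α a rate t ξ : ℝ) : ℂ :=
  ((Real.exp (-(rate * t)) : ℂ) *
    (((-(1 + a * t) : ℝ) : ℂ) * (yuleDenom α rate t ξ)⁻¹
      + ((-(1 - Real.exp (-(rate * t))) : ℝ) : ℂ) *
        (expPsi α 1 ξ * (yuleDenom α rate t ξ)⁻¹ ^ 2))) * expPsi α (1 + a * t) ξ

section Index
variable {α : ℝ} (h1 : 1 < α) (h2 : α ≤ 2)
include h1 h2

/-- The time `t` may be negative here: differentiation at `t = 0` under the integral uses a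
two-sided neighbourhood. -/
theorem le_norm_yuleDenom (rate t ξ : ℝ) :
    1 - |1 - Real.exp (-(rate * t))| ≤ ‖yuleDenom α rate t ξ‖ := by
  have h := norm_sub_norm_le (1 : ℂ) ((1 - (Real.exp (-(rate * t)) : ℂ)) * expPsi α 1 ξ)
  have hz := norm_expPsi_le_one h1 h2 zero_le_one ξ
  rw [norm_mul, norm_one, ← Complex.ofReal_one, ← Complex.ofReal_sub, Complex.norm_real,
    Real.norm_eq_abs] at h
  rw [yuleDenom, ← Complex.ofReal_one, ← Complex.ofReal_sub]
  nlinarith [abs_nonneg (1 - Real.exp (-(rate * t)))]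

omit h1 h2 in
theorem one_sub_abs_one_sub_exp {rate t : ℝ} (hrate : 0 < rate) (ht : 0 ≤ t) :
    1 - |1 - Real.exp (-(rate * t))| = Real.exp (-(rate * t)) := by
  have : Real.exp (-(rate * t)) ≤ 1 := Real.exp_le_one_iff.mpr (by nlinarith)
  rw [abs_of_nonneg (by linarith)]
  ring

theorem exp_le_norm_yuleDenom {rate t : ℝ} (hrate : 0 < rate) (ht : 0 ≤ t) (ξ : ℝ) :
    Real.exp (-(rate * t)) ≤ ‖yuleDenom α rate t ξ‖ := by
  rw [← one_sub_abs_one_sub_exp hrate ht]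
  exact le_norm_yuleDenom h1 h2 rate t ξ

theorem yuleDenom_ne_zero {rate t : ℝ} (hrate : 0 < rate) (ht : 0 ≤ t) (ξ : ℝ) :
    yuleDenom α rate t ξ ≠ 0 :=
  norm_pos_iff.mp ((Real.exp_pos _).trans_le (exp_le_norm_yuleDenom h1 h2 hrate ht ξ))

theorem polyGrowth_inv_yuleDenom {rate t : ℝ} (hrate : 0 < rate) (ht : 0 ≤ t) :
    PolyGrowth (fun ξ => (yuleDenom α rate t ξ)⁻¹) := by
  have h : PolyGrowth (yuleDenom α rate t) := by
    have h := (PolyGrowth.const 1).add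
      ((polyGrowth_expPsi h1 h2 zero_le_one).const_mul (-(1 - Real.exp (-(rate * t)))))
    have e : yuleDenom α rate t = fun ξ => ((1 : ℝ) : ℂ) +
        ((-(1 - Real.exp (-(rate * t))) : ℝ) : ℂ) * expPsi α 1 ξ := by
      ext ξ
      rw [yuleDenom]
      push_cast
      ring
    rw [e]
    exact h
  exact h.inv (Real.exp_pos (-(rate * t))) (exp_le_norm_yuleDenom h1 h2 hrate ht)

theorem expDecay_yuleStable {a rate t : ℝ} (ha : 0 ≤ a) (hrate : 0 < rate) (ht : 0 ≤ t) :
    ExpDecay (yuleStable α a rate t) :=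
  (expDecay_expPsi h1 h2 (show 0 < 1 + a * t by positivity)).mul
    ((polyGrowth_inv_yuleDenom h1 h2 hrate ht).const_mul _)

theorem expDecay_yuleStableDeriv {a rate t : ℝ} (ha : 0 ≤ a) (hrate : 0 < rate) (ht : 0 ≤ t) :
    ExpDecay (yuleStableDeriv α a rate t) := by
  have hD := polyGrowth_inv_yuleDenom h1 h2 hrate ht
  exact (expDecay_expPsi h1 h2 (show 0 < 1 + a * t by positivity)).mul
    (((hD.const_mul _).add
      (((polyGrowth_expPsi h1 h2 zero_le_one).mul (hD.pow 2)).const_mul _)).const_mul _)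

theorem norm_inv_yuleDenom_le {rate t : ℝ} (hrate : 0 < rate) (ht : 0 ≤ t) (ξ : ℝ) :
    ‖(yuleDenom α rate t ξ)⁻¹‖ ≤ (Real.exp (-(rate * t)))⁻¹ := by
  rw [norm_inv]
  exact inv_anti₀ (Real.exp_pos _) (exp_le_norm_yuleDenom h1 h2 hrate ht ξ)

/-- `ExpDecay` keeps only a bound `e^{-δ|ξ|}`; uniform convergence of the series needs the sharp
decay of `e^{-(1+at)ψ}`. -/
theorem exists_norm_yuleStable_le (a : ℝ) {rate t : ℝ} (hrate : 0 < rate) (ht : 0 ≤ t) :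
    ∃ K, ∀ ξ, ‖yuleStable α a rate t ξ‖ ≤ K * ‖expPsi α (1 + a * t) ξ‖ := by
  refine ⟨Real.exp (-(rate * t)) * (Real.exp (-(rate * t)))⁻¹, fun ξ => ?_⟩
  rw [yuleStable, norm_mul, norm_mul, Complex.norm_real, Real.norm_of_nonneg (Real.exp_pos _).le]
  gcongr
  exact norm_inv_yuleDenom_le h1 h2 hrate ht ξ

theorem exists_norm_yuleStableDeriv_le (a : ℝ) {rate t : ℝ} (hrate : 0 < rate) (ht : 0 ≤ t) :
    ∃ K, ∀ ξ, ‖yuleStableDeriv α a rate t ξ‖ ≤ K * ‖expPsi α (1 + a * t) ξ‖ := by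
  set q := Real.exp (-(rate * t)) with hq
  refine ⟨q * (|-(1 + a * t)| * q⁻¹ + |-(1 - q)| * (1 * q⁻¹ ^ 2)), fun ξ => ?_⟩
  have hD := norm_inv_yuleDenom_le h1 h2 hrate ht ξ
  rw [yuleStableDeriv, norm_mul, norm_mul, Complex.norm_real,
    Real.norm_of_nonneg (Real.exp_pos _).le]
  gcongr
  refine (norm_add_le _ _).trans ?_
  rw [norm_mul, norm_mul, norm_mul, norm_pow, Complex.norm_real, Complex.norm_real,
    Real.norm_eq_abs, Real.norm_eq_abs]
  gcongr
  exact norm_expPsi_le_one h1 h2 zero_le_one ξ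

theorem hasDerivAt_yuleStable (a : ℝ) {rate t : ℝ} (hrate : 0 < rate) (ht : 0 ≤ t) (ξ : ℝ) :
    HasDerivAt (yuleStable α a rate t) (yuleStableDeriv α a rate t ξ * psiDeriv α ξ) ξ := by
  have hD0 := yuleDenom_ne_zero h1 h2 hrate ht ξ
  have hD : HasDerivAt (yuleDenom α rate t)
      (-((1 - (Real.exp (-(rate * t)) : ℂ)) * (-((1 : ℝ) : ℂ) * psiDeriv α ξ * expPsi α 1 ξ))) ξ :=
    ((hasDerivAt_expPsi h1 1 ξ).const_mul _).const_sub 1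
  refine (((hD.inv hD0).const_mul (Real.exp (-(rate * t)) : ℂ)).mul
    (hasDerivAt_expPsi h1 (1 + a * t) ξ)).congr_deriv ?_
  simp only [yuleStableDeriv, Pi.inv_apply]
  push_cast
  field_simp
  ring

omit h1 h2 in
-- The generating function `G(z, t)` of the birth process satisfies `G_t = λ z (z - 1) G_z`. With `z
-- = e^{-ψ}` this is `G_t = λ (1 - e^{-ψ}) ∂_ψ G`, and the factor `e^{-atψ}` contributes the terms
-- with `a`.
theorem hasDerivAt_yuleStable_time (a rate t ξ : ℝ) (hD0 : yuleDenom α rate t ξ ≠ 0) :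
    HasDerivAt (fun t => yuleStable α a rate t ξ)
      (a * (-psiSymbol α (2 - α) ξ * yuleStable α a rate t ξ
          + (rate * t : ℝ) * (yuleStable α a rate t ξ - expPsi α 1 ξ * yuleStable α a rate t ξ))
        + rate * (yuleStableDeriv α a rate t ξ - expPsi α 1 ξ * yuleStableDeriv α a rate t ξ))
      t := by
  have hq : HasDerivAt (fun t : ℝ => (Real.exp (-(rate * t)) : ℂ))
      ((Real.exp (-(rate * t)) * (-(rate * 1)) : ℝ) : ℂ) t :=
    (((hasDerivAt_id t).const_mul rate).neg.exp).ofReal_comp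
  have hE : HasDerivAt (fun t : ℝ => expPsi α (1 + a * t) ξ)
      (expPsi α (1 + a * t) ξ * (-((a * 1 : ℝ) : ℂ) * psiSymbol α (2 - α) ξ)) t :=
    (((((hasDerivAt_id t).const_mul a).const_add 1).ofReal_comp.neg).mul_const _).cexp
  have hD : HasDerivAt (fun t : ℝ => yuleDenom α rate t ξ)
      (-(-((Real.exp (-(rate * t)) * (-(rate * 1)) : ℝ) : ℂ) * expPsi α 1 ξ)) t :=
    (((hq.const_sub 1).mul_const _).const_sub 1)
  refine ((hq.mul (hD.inv hD0)).mul hE).congr_deriv ?_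
  simp only [yuleStableDeriv, yuleStable, Pi.inv_apply, Pi.mul_apply]
  have hDe : (Real.exp (-(rate * t)) : ℂ) * expPsi α 1 ξ
      = yuleDenom α rate t ξ - 1 + expPsi α 1 ξ := by
    rw [yuleDenom]; ring
  push_cast at hDe ⊢
  set D := yuleDenom α rate t ξ
  set q := Complex.exp (-(rate * t))
  set z := expPsi α 1 ξ
  set E := expPsi α (1 + a * t) ξ
  field_simp
  linear_combination (E * q * rate * z) * hDe

omit h2 in
theorem yuleStable_zero_freq (a : ℝ) (rate t : ℝ) :
    yuleStable α a rate t 0 = 1 := by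
  have h0 : ∀ c, expPsi α c 0 = 1 := fun c => by
    simp [expPsi, psiSymbol_zero (show α ≠ 0 by linarith)]
  have : (Real.exp (-(rate * t)) : ℂ) ≠ 0 := by exact_mod_cast (Real.exp_pos _).ne'
  rw [yuleStable, yuleDenom, h0, h0]
  field_simp
  ring_nf

/-- Mean value inequality between `0` and `ξ`, where the derivative is at most `K α |ξ|^{α-1}`. This
feeds the first-moment estimate. -/
theorem norm_one_sub_yuleStable_le {a rate t : ℝ} (ha : 0 ≤ a) (hrate : 0 < rate) (ht : 0 ≤ t) :
    ∃ C, ∀ ξ, ‖1 - yuleStable α a rate t ξ‖ ≤ C * |ξ| ^ α := by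
  obtain ⟨K, hK⟩ := exists_norm_yuleStableDeriv_le h1 h2 a hrate ht
  have hK0 : 0 ≤ K := by
    by_contra! h
    have := hK 0
    have h3 : 0 < ‖expPsi α (1 + a * t) 0‖ := norm_pos_iff.mpr (Complex.exp_ne_zero _)
    nlinarith [norm_nonneg (yuleStableDeriv α a rate t 0)]
  refine ⟨K * α, fun ξ => ?_⟩
  have h := Convex.norm_image_sub_le_of_norm_hasDerivWithin_le (𝕜 := ℝ)
    (f := yuleStable α a rate t) (s := Set.uIcc 0 ξ) (x := 0) (y := ξ)
    (C := K * (α * |ξ| ^ (α - 1)))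
    (fun η _ => (hasDerivAt_yuleStable h1 h2 a hrate ht η).hasDerivWithinAt)
    (fun η hη => by
      have hle : |η| ≤ |ξ| := by
        have := Set.abs_sub_left_of_mem_uIcc hη
        simpa using this
      rw [norm_mul, norm_psiDeriv h1]
      have hE := norm_expPsi_le_one h1 h2 (show 0 ≤ 1 + a * t by positivity) η
      gcongr
      · exact (hK η).trans (mul_le_of_le_one_right hK0 hE))
    (convex_uIcc 0 ξ) Set.left_mem_uIcc Set.right_mem_uIcc
  rw [yuleStable_zero_freq h1, sub_zero, Real.norm_eq_abs, ← norm_neg, neg_sub] at h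
  refine h.trans (le_of_eq ?_)
  rcases eq_or_ne ξ 0 with rfl | h0
  · simp [Real.zero_rpow (show α ≠ 0 by linarith)]
  · have : |ξ| ^ α = |ξ| ^ (α - 1) * |ξ| := by
      rw [← Real.rpow_add_one (by positivity)]; congr 1; ring
    rw [this]; ring

theorem hasDerivAt_invFourierPos_yuleStable {a rate t : ℝ} (ha : 0 ≤ a) (hrate : 0 < rate)
    (ht : 0 ≤ t) (x : ℝ) :
    HasDerivAt (fun s => invFourierPos (yuleStable α a rate s) x)
      (a * (invFourierPos (fun ξ => -psiSymbol α (2 - α) ξ * yuleStable α a rate t ξ) x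
          + rate * t * (invFourierPos (yuleStable α a rate t) x
            - invFourierPos (fun ξ => expPsi α 1 ξ * yuleStable α a rate t ξ) x))
        + rate * (invFourierPos (yuleStableDeriv α a rate t) x
          - invFourierPos (fun ξ => expPsi α 1 ξ * yuleStableDeriv α a rate t ξ) x)) t := by
  have hφ := expDecay_yuleStable h1 h2 ha hrate ht
  have hχ := expDecay_yuleStableDeriv h1 h2 ha hrate ht
  have hz := polyGrowth_expPsi h1 h2 zero_le_one
  have hψ := polyGrowth_psiSymbol h1 h2
  set κ := Real.exp (-(rate * t)) / 2 with hκ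
  have hκ0 : 0 < κ := by positivity
  -- Near `t` the denominator stays above half its bound at `t`, and the exponent `1 + as` stays
  -- above `1/2`, so `e^{-ψ/2}` can serve as dominating factor.
  have hev : ∀ᶠ s in 𝓝 t, κ < 1 - |1 - Real.exp (-(rate * s))| ∧ 1 / 2 < 1 + a * s := by
    refine ((by fun_prop : Continuous fun s => 1 - |1 - Real.exp (-(rate * s))|).tendsto
      t).eventually_const_lt ?_ |>.and
      (((by fun_prop : Continuous fun s => 1 + a * s).tendsto t).eventually_const_lt ?_)
    · rw [one_sub_abs_one_sub_exp hrate ht, hκ]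
      linarith [Real.exp_pos (-(rate * t))]
    · have : 0 ≤ a * t := by positivity
      linarith
  let F' : ℝ → ℝ → ℂ := fun s ξ =>
    (a * (-psiSymbol α (2 - α) ξ * yuleStable α a rate s ξ
          + (rate * s : ℝ) * (yuleStable α a rate s ξ - expPsi α 1 ξ * yuleStable α a rate s ξ))
        + rate * (yuleStableDeriv α a rate s ξ - expPsi α 1 ξ * yuleStableDeriv α a rate s ξ))
  have hE := expDecay_expPsi h1 h2 (show (0 : ℝ) < 1 / 2 by norm_num)
  have hi1 := (hφ.mul hψ.neg).integrable
  have hi2 := (hφ.mul hz).integrable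
  have hi3 := (hχ.mul hz).integrable
  have hi4 := (hφ.integrable.sub hi2).const_mul ((rate * t : ℝ) : ℂ)
  have hi5 := hχ.integrable.sub hi3
  have hmeas : ∀ s, Continuous (fun ξ => expPsi α s ξ) := fun s => by
    have := hψ.differentiable.continuous
    unfold expPsi
    fun_prop
  have hF'int : Integrable (F' t) :=
    ((hi1.add hi4).const_mul (a : ℂ)).add (hi5.const_mul (rate : ℂ))
  have h := (hasDerivAt_integral_of_dominated_loc_of_deriv_le (μ := volume) (𝕜 := ℝ)
    (F := fun (s : ℝ) (ξ : ℝ) => Complex.exp (-(Complex.I * ξ * x)) * yuleStable α a rate s ξ)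
    (F' := fun (s : ℝ) (ξ : ℝ) => Complex.exp (-(Complex.I * ξ * x)) * F' s ξ)
    (x₀ := t) (s := {s | κ < 1 - |1 - Real.exp (-(rate * s))| ∧ 1 / 2 < 1 + a * s})
    (bound := fun ξ => a * 2 / κ * ‖psiSymbol α (2 - α) ξ * expPsi α (1 / 2) ξ‖
      + 2 * rate * 2 / κ ^ 2 * ‖expPsi α (1 / 2) ξ‖) hev
    (by
      filter_upwards with s
      refine ((by fun_prop : Continuous fun ξ : ℝ =>
        Complex.exp (-(Complex.I * ξ * x))).measurable.mul ?_).aestronglyMeasurable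
      have hm1 := (hmeas 1).measurable
      have hm2 := (hmeas (1 + a * s)).measurable
      unfold yuleStable yuleDenom
      fun_prop)
    (integrable_exp_mul hφ.integrable x)
    (integrable_exp_mul hF'int x).1
    (ae_of_all _ fun ξ s hs => by
      have hDn : κ ≤ ‖yuleDenom α rate s ξ‖ := hs.1.le.trans (le_norm_yuleDenom h1 h2 rate s ξ)
      have hD0 : yuleDenom α rate s ξ ≠ 0 := norm_pos_iff.mp (hκ0.trans_le hDn)
      have hq2 : Real.exp (-(rate * s)) ≤ 2 := by
        have h3 := hs.1
        have h4 := neg_abs_le (1 - Real.exp (-(rate * s)))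
        linarith
      have hEs : ‖expPsi α (1 + a * s) ξ‖ ≤ ‖expPsi α (1 / 2) ξ‖ := by
        rw [norm_expPsi h1, norm_expPsi h1, Real.exp_le_exp]
        have hc := cos_pos_of_index h1 h2
        have h3 : 0 ≤ Real.cos ((2 - α) * Real.pi / 2) * |ξ| ^ α := by positivity
        nlinarith [hs.2]
      -- The terms with the factor `s` cancel and `D + (1 - q) e^{-ψ} = 1`, where `D` is the
      -- denominator, leaving two terms that are bounded one by one.
      have hform : F' s ξ = -(a * psiSymbol α (2 - α) ξ * Real.exp (-(rate * s)) *
            (yuleDenom α rate s ξ)⁻¹ * expPsi α (1 + a * s) ξ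
          + rate * Real.exp (-(rate * s)) * (1 - expPsi α 1 ξ) *
            (yuleDenom α rate s ξ)⁻¹ ^ 2 * expPsi α (1 + a * s) ξ) := by
        simp only [F', yuleStable, yuleStableDeriv]
        have hDe : (Real.exp (-(rate * s)) : ℂ) * expPsi α 1 ξ
            = yuleDenom α rate s ξ - 1 + expPsi α 1 ξ := by
          rw [yuleDenom]; ring
        push_cast at hDe ⊢
        set D := yuleDenom α rate s ξ
        set q := Complex.exp (-(rate * s))
        set z := expPsi α 1 ξ
        set E := expPsi α (1 + a * s) ξ
        field_simp
        linear_combination (E * q * rate * (1 - z)) * hDe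
      have hexp : ‖Complex.exp (-(Complex.I * ξ * x))‖ = 1 := by simp [Complex.norm_exp]
      have hz1 : ‖1 - expPsi α 1 ξ‖ ≤ 2 := by
        refine (norm_sub_le _ _).trans ?_
        rw [norm_one]
        linarith [norm_expPsi_le_one h1 h2 zero_le_one ξ]
      have hDi : ‖(yuleDenom α rate s ξ)⁻¹‖ ≤ κ⁻¹ := by
        rw [norm_inv]; exact inv_anti₀ hκ0 hDn
      rw [norm_mul, hexp, one_mul, hform, norm_neg]
      refine (norm_add_le _ _).trans ?_
      simp only [norm_mul, norm_pow, Complex.norm_real, Real.norm_of_nonneg ha,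
        Real.norm_of_nonneg hrate.le, Real.norm_of_nonneg (Real.exp_pos _).le]
      have e1 : a * 2 / κ * (‖psiSymbol α (2 - α) ξ‖ * ‖expPsi α (1 / 2) ξ‖)
          = a * ‖psiSymbol α (2 - α) ξ‖ * 2 * κ⁻¹ * ‖expPsi α (1 / 2) ξ‖ := by ring
      have e2 : 2 * rate * 2 / κ ^ 2 * ‖expPsi α (1 / 2) ξ‖
          = rate * 2 * 2 * κ⁻¹ ^ 2 * ‖expPsi α (1 / 2) ξ‖ := by ring
      rw [e1, e2]
      gcongr)
    (((hE.mul hψ).integrable.norm.const_mul _).add (hE.integrable.norm.const_mul _))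
    (ae_of_all _ fun ξ s hs => by
      have hDn : κ ≤ ‖yuleDenom α rate s ξ‖ := hs.1.le.trans (le_norm_yuleDenom h1 h2 rate s ξ)
      have hD0 : yuleDenom α rate s ξ ≠ 0 := norm_pos_iff.mp (hκ0.trans_le hDn)
      exact (hasDerivAt_yuleStable_time a rate s ξ hD0).const_mul _)).2
  have h' := Complex.reCLM.hasFDerivAt.comp_hasDerivAt t (h.const_mul (2 * Real.pi : ℂ)⁻¹)
  refine HasDerivAt.congr_deriv (f := fun s => invFourierPos (yuleStable α a rate s) x) h' ?_
  change invFourierPos (F' t) x = _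
  have s1 := invFourierPos_add ((hi1.add hi4).const_mul (a : ℂ)) (hi5.const_mul (rate : ℂ)) x
  refine Eq.trans s1 ?_
  rw [invFourierPos_const_mul, invFourierPos_const_mul]
  have s2 := invFourierPos_add hi1 hi4 x
  have s3 := invFourierPos_sub hχ.integrable hi3 x
  have s4 := invFourierPos_sub hφ.integrable hi2 x
  congr 2
  refine Eq.trans s2 ?_
  rw [invFourierPos_const_mul]
  congr 2

end Index

/-! ### Uniform convergence of the exponential series -/

theorem hasDerivAt_expPartialSum (N : ℕ) (u : ℂ) :
    HasDerivAt (fun u : ℂ => ∑ n ∈ Finset.range (N + 1), u ^ n / (n.factorial : ℂ))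
      (∑ n ∈ Finset.range N, u ^ n / (n.factorial : ℂ)) u := by
  induction N with
  | zero => simpa using hasDerivAt_const u (1 : ℂ)
  | succ N ih =>
    have h := ih.fun_add ((hasDerivAt_pow (N + 1) u).div_const ((N + 1).factorial : ℂ))
    simp only [Finset.sum_range_succ _ (N + 1)]
    rw [Finset.sum_range_succ _ N]
    refine h.congr_deriv ?_
    congr 1
    have : (N.factorial : ℂ) ≠ 0 := by exact_mod_cast N.factorial_ne_zero
    have : (N + 1 : ℂ) ≠ 0 := by exact_mod_cast N.succ_ne_zero
    rw [Nat.factorial_succ]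
    push_cast
    field_simp

/-- Along the segment `s w`, `0 ≤ s ≤ 1`, which stays in the right half-plane, each remainder has
derivative `-w` times the previous one; `|e^{-sw}| ≤ 1` starts the induction. -/
theorem norm_exp_neg_sub_sum_le (N : ℕ) {w : ℂ} (hw : 0 ≤ w.re) :
    ‖Complex.exp (-w) - ∑ n ∈ Finset.range N, (-w) ^ n / (n.factorial : ℂ)‖
      ≤ ‖w‖ ^ N / N.factorial := by
  induction N generalizing w with
  | zero => simpa [Complex.norm_exp] using hw
  | succ N ih =>
    have hd : ∀ s : ℝ, HasDerivAt (fun s : ℝ => Complex.exp (-(s * w))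
        - ∑ n ∈ Finset.range (N + 1), (-(s * w)) ^ n / (n.factorial : ℂ))
        ((Complex.exp (-(s * w)) - ∑ n ∈ Finset.range N, (-(s * w)) ^ n / (n.factorial : ℂ))
          * (-w)) s := fun s => by
      have h1 : HasDerivAt (fun s : ℝ => -((s : ℂ) * w)) (-w) s := by
        simpa using ((Complex.ofRealCLM.hasDerivAt (x := s)).mul_const w).fun_neg
      have h2 := h1.cexp.fun_sub ((hasDerivAt_expPartialSum N (-((s : ℂ) * w))).comp s h1)
      refine h2.congr_deriv ?_
      ring
    have hB : ∀ s : ℝ, HasDerivAt (fun s : ℝ => s ^ (N + 1) * (‖w‖ ^ (N + 1) / (N + 1).factorial))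
        ((N + 1 : ℕ) * s ^ N * (‖w‖ ^ (N + 1) / (N + 1).factorial)) s := fun s =>
      (hasDerivAt_pow (N + 1) s).mul_const _
    have h := image_norm_le_of_norm_deriv_right_le_deriv_boundary (a := 0) (b := 1)
      (fun s _ => (hd s).continuousAt.continuousWithinAt)
      (fun s _ => (hd s).hasDerivWithinAt) (by simp [Finset.sum_range_succ']) hB
      (fun s hs => by
        have hre : 0 ≤ ((s : ℂ) * w).re := by
          rw [Complex.re_ofReal_mul]; exact mul_nonneg hs.1 hw
        rw [norm_mul, norm_neg]
        refine (mul_le_mul_of_nonneg_right (ih hre) (norm_nonneg _)).trans (le_of_eq ?_)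
        rw [norm_mul, Complex.norm_real, Real.norm_of_nonneg hs.1, Nat.factorial_succ]
        have : (N.factorial : ℝ) ≠ 0 := by exact_mod_cast N.factorial_ne_zero
        have : (N + 1 : ℝ) ≠ 0 := by exact_mod_cast N.succ_ne_zero
        push_cast
        field_simp
        ring) (x := 1) (by simp)
    simpa using h

/-- Log-convexity of `Γ` between `N` and `N + 1`. -/
theorem Gamma_add_div_factorial_le {s : ℝ} (h0 : 0 < s) (h1 : s < 1) {N : ℕ} (hN : 0 < N) :
    Real.Gamma (N + s) / N.factorial ≤ (N : ℝ) ^ (-(1 - s)) := by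
  have hN' : (0 : ℝ) < N := by exact_mod_cast hN
  have h := Real.Gamma_mul_add_mul_le_rpow_Gamma_mul_rpow_Gamma hN'
    (show (0 : ℝ) < N + 1 by positivity) (show 0 < 1 - s by linarith) h0 (by ring)
  have e : (1 - s) * N + s * (N + 1) = N + s := by ring
  have hG : Real.Gamma N = Real.Gamma (N + 1) / N := by
    rw [Real.Gamma_add_one hN'.ne']; field_simp
  have hpos : 0 < Real.Gamma (N + 1) := Real.Gamma_pos_of_pos (by positivity)
  rw [e, hG, Real.div_rpow hpos.le hN'.le, div_mul_eq_mul_div, ← Real.rpow_add hpos,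
    sub_add_cancel, Real.rpow_one, Real.Gamma_nat_eq_factorial] at h
  rw [div_le_iff₀ (by positivity), Real.rpow_neg hN'.le]
  exact h.trans (le_of_eq (by ring))

theorem tendsto_Gamma_add_div_factorial {s : ℝ} (h0 : 0 < s) (h1 : s < 1) :
    Tendsto (fun N : ℕ => Real.Gamma (N + s) / N.factorial) atTop (𝓝 0) := by
  have h := (tendsto_rpow_neg_atTop (show 0 < 1 - s by linarith)).comp
    (tendsto_natCast_atTop_atTop (R := ℝ))
  refine squeeze_zero' (Eventually.of_forall fun N => ?_) ?_ h
  · have := (Real.Gamma_pos_of_pos (show (0 : ℝ) < N + s by positivity)).le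
    positivity
  · filter_upwards [eventually_gt_atTop 0] with N hN
    exact Gamma_add_div_factorial_le h0 h1 hN

theorem integral_abs_rpow_pow_mul_exp {α : ℝ} (h : 0 < α) (N : ℕ) :
    ∫ ξ : ℝ, (|ξ| ^ α) ^ N * Real.exp (-|ξ| ^ α) = 2 / α * Real.Gamma (N + 1 / α) := by
  rw [integral_comp_abs (f := fun r => (r ^ α) ^ N * Real.exp (-r ^ α))]
  have e := integral_rpow_mul_exp_neg_rpow h
    (show -1 < α * N by linarith [show 0 ≤ α * N by positivity])
  have e2 : ∫ r in Set.Ioi (0 : ℝ), (r ^ α) ^ N * Real.exp (-r ^ α)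
      = ∫ r in Set.Ioi (0 : ℝ), r ^ (α * N) * Real.exp (-r ^ α) := by
    refine setIntegral_congr_fun measurableSet_Ioi fun r hr => ?_
    rw [Real.rpow_mul (le_of_lt hr), Real.rpow_natCast]
  rw [e2, e]
  have : (α * N + 1) / α = N + 1 / α := by field_simp
  rw [this]
  ring

theorem integrable_abs_rpow_pow_mul_exp {α : ℝ} (h : 0 < α) (N : ℕ) :
    Integrable (fun ξ : ℝ => (|ξ| ^ α) ^ N * Real.exp (-|ξ| ^ α)) := by
  -- A non-integrable function would have integral `0`, whereas the computed value is positive.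
  refine not_imp_comm.mp integral_undef ?_
  rw [integral_abs_rpow_pow_mul_exp h]
  have := Real.Gamma_pos_of_pos (show (0 : ℝ) < N + 1 / α by positivity)
  positivity

/-- The exponential series of the Riesz-Feller derivative converges uniformly on functions whose
Fourier transform is `O(e^{-|ξ|^α})`. -/
theorem tendstoUniformly_exp_series {α : ℝ} (h1 : 1 < α) (h2 : α ≤ 2) {g : ℝ → ℂ}
    (hg : ExpDecay g) {K : ℝ} (hK : ∀ ξ, ‖g ξ‖ ≤ K * Real.exp (-|ξ| ^ α)) :
    TendstoUniformly (fun (N : ℕ) (x : ℝ) => ∑ n ∈ Finset.range N, 1 / (n.factorial : ℝ) *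
        invFourierPos (fun ξ => (-psiSymbol α (2 - α) ξ) ^ n * g ξ) x)
      (invFourierPos fun ξ => expPsi α 1 ξ * g ξ) atTop := by
  have hα : 0 < α := by linarith
  have hψ := polyGrowth_psiSymbol h1 h2
  have hz := (hg.mul (polyGrowth_expPsi h1 h2 zero_le_one)).integrable
  have hn := fun n : ℕ => (hg.mul (hψ.neg.pow n)).integrable
  have hs := fun N : ℕ => integrable_finsetSum (Finset.range N) fun n _ =>
    (hn n).const_mul ((1 / (n.factorial : ℝ) : ℝ) : ℂ)
  have key : ∀ (N : ℕ) (x : ℝ), |invFourierPos (fun ξ => expPsi α 1 ξ * g ξ) x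
      - ∑ n ∈ Finset.range N, 1 / (n.factorial : ℝ) *
        invFourierPos (fun ξ => (-psiSymbol α (2 - α) ξ) ^ n * g ξ) x|
      ≤ K * (2 / α) * (Real.Gamma (N + 1 / α) / N.factorial) := fun N x => by
    rw [← invFourierPos_sum _ _ _ hn, ← invFourierPos_sub hz (hs N)]
    refine (abs_invFourierPos_le x).trans ?_
    have e : K * (2 / α) * (Real.Gamma (N + 1 / α) / N.factorial)
        = ∫ ξ : ℝ, K / N.factorial * ((|ξ| ^ α) ^ N * Real.exp (-|ξ| ^ α)) := by
      rw [integral_const_mul, integral_abs_rpow_pow_mul_exp hα]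
      ring
    rw [e]
    refine integral_mono (hz.sub (hs N)).norm
      ((integrable_abs_rpow_pow_mul_exp hα N).const_mul _) fun ξ => ?_
    have hT := norm_exp_neg_sub_sum_le N (re_psiSymbol_nonneg h1 h2 ξ)
    have e2 : expPsi α 1 ξ * g ξ - ∑ n ∈ Finset.range N, ((1 / (n.factorial : ℝ) : ℝ) : ℂ) *
          ((-psiSymbol α (2 - α) ξ) ^ n * g ξ)
        = (Complex.exp (-psiSymbol α (2 - α) ξ) - ∑ n ∈ Finset.range N,
          (-psiSymbol α (2 - α) ξ) ^ n / (n.factorial : ℂ)) * g ξ := by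
      rw [sub_mul, Finset.sum_mul, expPsi]
      congr 1
      · simp
      · refine Finset.sum_congr rfl fun n _ => ?_
        push_cast
        ring
    simp only [e2]
    rw [norm_mul, ← norm_psiSymbol α (2 - α) ξ]
    calc _ ≤ ‖psiSymbol α (2 - α) ξ‖ ^ N / N.factorial * (K * Real.exp (-|ξ| ^ α)) :=
          mul_le_mul hT (hK ξ) (norm_nonneg _) (by positivity)
      _ = _ := by rw [norm_psiSymbol]; ring
  rw [Metric.tendstoUniformly_iff]
  intro ε hε
  -- Here `α > 1` is essential: the quotient decays like `N^{-(1 - 1/α)}`.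
  have ht := (tendsto_Gamma_add_div_factorial (s := 1 / α) (by positivity)
    (by rw [div_lt_one hα]; exact h1)).const_mul (K * (2 / α))
  rw [mul_zero] at ht
  filter_upwards [ht.eventually_lt_const hε] with N hN x
  exact (key N x).trans_lt hN

/-! ### Densities and first moments -/

theorem charFun_withDensity_ofReal {f : ℝ → ℝ} (hf : Measurable f) (ξ : ℝ) :
    charFun (volume.withDensity fun x => ENNReal.ofReal (f x)) ξ
      = ∫ x : ℝ, Complex.exp (Complex.I * ξ * x) * ((max (f x) 0 : ℝ) : ℂ) := by
  rw [charFun_apply_real, integral_withDensity_eq_integral_toReal_smul hf.ennreal_ofReal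
    (by simp)]
  congr 1 with x
  rw [ENNReal.toReal_ofReal', Complex.real_smul, mul_comm]
  congr 2
  ring

theorem integrable_exp_I_mul {f : ℝ → ℝ} (hf : Integrable f) (ξ : ℝ) :
    Integrable (fun x : ℝ => Complex.exp (Complex.I * ξ * x) * (f x : ℂ)) := by
  refine hf.norm.mono' ((by fun_prop : Continuous fun x : ℝ =>
    Complex.exp (Complex.I * ξ * x)).aestronglyMeasurable.mul
    (Complex.continuous_ofReal.comp_aestronglyMeasurable hf.1))
    (ae_of_all _ fun x => ?_)
  simp [Complex.norm_exp]

/-- A probability measure whose characteristic function is the Fourier transform of a continuous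
integrable function has that function as its density. -/
theorem isContinuousDensity_of_charFun {ν : Measure ℝ} [IsProbabilityMeasure ν] {u : ℝ → ℝ}
    (hc : Continuous u) (hi : Integrable u) (h : ∀ ξ, charFun ν ξ = fourierPos u ξ) :
    IsContinuousDensity ν u := by
  set P := volume.withDensity fun x => ENNReal.ofReal (u x) with hP
  set M := volume.withDensity fun x => ENNReal.ofReal (-u x) with hM
  have : IsFiniteMeasure P := isFiniteMeasure_withDensity_ofReal hi.2
  have : IsFiniteMeasure M := isFiniteMeasure_withDensity_ofReal hi.neg.2
  have hmn : Measurable fun x => -u x := hc.measurable.neg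
  -- `P` and `M` have densities the positive and negative parts of `u`, whose sign is not yet known.
  -- Characteristic functions identify finite measures.
  have hadd : ν + M = P := by
    refine Measure.ext_of_charFun (funext fun ξ => ?_)
    have hb : ∀ (m : Measure ℝ) [IsFiniteMeasure m],
        Integrable (fun x : ℝ => Complex.exp (ξ * x * Complex.I)) m := fun m _ =>
      (integrable_const (1 : ℝ)).mono' (by fun_prop) (ae_of_all _ fun x => by
        simp [Complex.norm_exp])
    have e : charFun (ν + M) ξ = charFun ν ξ + charFun M ξ := by
      simp only [charFun_apply_real]
      exact integral_add_measure (hb ν) (hb M)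
    rw [e, h, hM, hP, charFun_withDensity_ofReal hc.measurable,
      charFun_withDensity_ofReal hmn, fourierPos,
      ← integral_add (integrable_exp_I_mul hi ξ)
        (integrable_exp_I_mul (f := fun x => max (-u x) 0) hi.neg.pos_part ξ)]
    congr 1 with x
    rw [← mul_add, ← Complex.ofReal_add]
    congr 2
    rcases le_total 0 (u x) with h | h
    · rw [max_eq_left h, max_eq_right (by linarith)]; ring
    · rw [max_eq_right h, max_eq_left (by linarith)]; ring
  have hnn : ∀ x, 0 ≤ u x := by
    -- Since `M ≤ P` and `P` does not charge `{u < 0}`, neither does `M`; so this open set is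
    -- Lebesgue-null, hence empty.
    have hs : P {x | u x < 0} = 0 := by
      rw [hP, withDensity_apply_eq_zero hc.measurable.ennreal_ofReal]
      convert! measure_empty (μ := (volume : Measure ℝ))
      ext x
      simp only [Set.mem_inter_iff, Set.mem_ofPred_eq, Set.mem_empty_iff_false, iff_false, not_and,
        not_lt]
      intro hx
      simpa using (not_le.mp (fun hle => hx (ENNReal.ofReal_of_nonpos hle))).le
    have hs' : M {x | u x < 0} = 0 := by
      rw [← hadd, Measure.add_apply] at hs
      exact (add_eq_zero.mp hs).2
    rw [hM, withDensity_apply_eq_zero hmn.ennreal_ofReal] at hs'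
    have hopen : IsOpen {x | u x < 0} := isOpen_lt hc continuous_const
    have hset : {x | ENNReal.ofReal (-u x) ≠ 0} ∩ {x | u x < 0} = {x | u x < 0} := by
      ext x
      simp
    rw [hset, hopen.measure_eq_zero_iff volume] at hs'
    intro x
    by_contra! hx
    have : x ∈ {x | u x < 0} := hx
    rw [hs'] at this
    exact this
  refine ⟨hc, hnn, ?_⟩
  have hM0 : M = 0 := by
    have : (fun x => ENNReal.ofReal (-u x)) = 0 := by
      ext x
      simp [hnn x]
    rw [hM, this, withDensity_zero]
  rw [← hP, ← hadd, hM0, add_zero]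

theorem IsContinuousDensity.unique {ν : Measure ℝ} {f g : ℝ → ℝ} (hf : IsContinuousDensity ν f)
    (hg : IsContinuousDensity ν g) : f = g := by
  have h := hf.eq_withDensity.symm.trans hg.eq_withDensity
  rw [withDensity_eq_iff_of_sigmaFinite hf.continuous.measurable.ennreal_ofReal.aemeasurable
    hg.continuous.measurable.ennreal_ofReal.aemeasurable] at h
  refine Continuous.ae_eq_iff_eq volume hf.continuous hg.continuous |>.mp ?_
  filter_upwards [h] with x hx
  exact (ENNReal.ofReal_eq_ofReal_iff (hf.nonneg x) (hg.nonneg x)).mp hx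

/-- The tail beyond `r` is controlled by the integral of `1 - charFun` over `[-2/r, 2/r]`, an
interval of length `4/r`. -/
theorem measureReal_abs_gt_le_of_charFun {ν : Measure ℝ} [IsProbabilityMeasure ν] {α C : ℝ}
    (hα : 0 < α) (h : ∀ ξ, ‖1 - charFun ν ξ‖ ≤ C * |ξ| ^ α) {r : ℝ} (hr : 0 < r) :
    ν.real {x | r < |x|} ≤ 2 * C * 2 ^ α * r ^ (-α) := by
  have hC : 0 ≤ C := by simpa using (norm_nonneg _).trans (h 1)
  refine (measureReal_abs_gt_le_integral_charFun hr).trans ?_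
  have hb := intervalIntegral.norm_integral_le_of_norm_le_const
    (f := fun t => 1 - charFun ν t) (a := -2 * r⁻¹) (b := 2 * r⁻¹) (C := C * (2 * r⁻¹) ^ α)
    (fun t ht => by
      refine (h t).trans ?_
      have : |t| ≤ 2 * r⁻¹ := by
        rw [Set.uIoc_of_le (by nlinarith [inv_pos.mpr hr])] at ht
        exact abs_le.mpr ⟨by linarith [ht.1], ht.2⟩
      gcongr)
  calc _ ≤ 2⁻¹ * r * (C * (2 * r⁻¹) ^ α * |2 * r⁻¹ - -2 * r⁻¹|) := by gcongr
    _ = _ := by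
      rw [Real.mul_rpow (by norm_num) (by positivity), Real.rpow_neg hr.le,
        Real.inv_rpow hr.le, abs_of_pos (by nlinarith [inv_pos.mpr hr])]
      field_simp
      ring

/-- A probability measure with `1 - charFun = O(|ξ|^α)`, `α > 1`, has a first moment. -/
theorem integrable_id_of_charFun {ν : Measure ℝ} [IsProbabilityMeasure ν] {α C : ℝ} (hα : 1 < α)
    (h : ∀ ξ, ‖1 - charFun ν ξ‖ ≤ C * |ξ| ^ α) : Integrable (fun x => x) ν := by
  refine ⟨by fun_prop, ?_⟩
  rw [hasFiniteIntegral_iff_norm]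
  simp only [Real.norm_eq_abs]
  -- Layer-cake formula: tails are at most `1` on `(0, 1]` and `O(r^{-α})`, integrable, beyond `1`.
  rw [lintegral_eq_lintegral_meas_lt ν (ae_of_all _ fun x => abs_nonneg x) (by fun_prop),
    ← Set.Ioc_union_Ioi_eq_Ioi zero_le_one]
  refine (lintegral_union_le _ _ _).trans_lt (ENNReal.add_lt_top.mpr ⟨?_, ?_⟩)
  · calc _ ≤ ∫⁻ _ in Set.Ioc (0 : ℝ) 1, 1 := lintegral_mono fun _ => prob_le_one
      _ < ∞ := by simp
  · have hi := (integrableOn_Ioi_rpow_of_lt (show -α < -1 by linarith) zero_lt_one).const_mul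
      (2 * C * 2 ^ α)
    refine lt_of_le_of_lt (setLIntegral_mono' measurableSet_Ioi fun r hr => ?_)
      (IntegrableOn.setLIntegral_lt_top hi)
    have hr0 : 0 < r := zero_lt_one.trans hr
    rw [← ofReal_measureReal]
    exact ENNReal.ofReal_le_ofReal (measureReal_abs_gt_le_of_charFun (by linarith) h hr0)

theorem IsContinuousDensity.integrable_mul {ν : Measure ℝ} {u : ℝ → ℝ}
    (hu : IsContinuousDensity ν u) (h : Integrable (fun x => x) ν) :
    Integrable (fun x => x * u x) := by
  rw [hu.eq_withDensity, integrable_withDensity_iff hu.continuous.measurable.ennreal_ofReal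
    (by simp)] at h
  simpa [ENNReal.toReal_ofReal (hu.nonneg _)] using h

theorem hasDerivAt_fourierPos {f : ℝ → ℝ} (hf : Integrable f) (hxf : Integrable fun x => x * f x)
    (ξ : ℝ) :
    HasDerivAt (fourierPos f) (Complex.I * fourierPos (fun x => x * f x) ξ) ξ := by
  have h := (hasDerivAt_integral_of_dominated_loc_of_deriv_le (μ := volume) (𝕜 := ℝ)
    (F := fun (ξ : ℝ) (x : ℝ) => Complex.exp (Complex.I * ξ * x) * (f x : ℂ))
    (F' := fun (ξ : ℝ) (x : ℝ) =>
      Complex.I * (Complex.exp (Complex.I * ξ * x) * ((x * f x : ℝ) : ℂ)))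
    (x₀ := ξ) (s := Set.univ) (bound := fun x => ‖x * f x‖) univ_mem
    (Eventually.of_forall fun y => (integrable_exp_I_mul hf y).1)
    (integrable_exp_I_mul hf ξ)
    ((integrable_exp_I_mul hxf ξ).const_mul _).1
    (ae_of_all _ fun x y _ => by
      rw [norm_mul, norm_mul]
      simp [Complex.norm_exp])
    hxf.norm
    (ae_of_all _ fun x y _ => by
      have h1 : HasDerivAt (fun y : ℝ => Complex.I * (y : ℂ) * x) (Complex.I * x) y := by
        simpa using ((Complex.ofRealCLM.hasDerivAt (x := y)).const_mul Complex.I).mul_const (x : ℂ)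
      refine (h1.cexp.mul_const (f x : ℂ)).congr_deriv ?_
      push_cast
      ring)).2
  rw [integral_const_mul] at h
  exact h

/-! ### The law of the Yule process -/

section Yule
variable {Ω : Type*} [MeasurableSpace Ω] {μ : Measure Ω}

/-- The integrand has the primitive `-(e^{-λy} - e^{-λt})^{n+1}`, with `λ` the rate. -/
theorem integral_yule_convolution (rate t : ℝ) (n : ℕ) :
    ∫ y in (0 : ℝ)..t, rate * (n + 1) * Real.exp (-(rate * (n + 1) * y)) *
      (1 - Real.exp (-(rate * (t - y)))) ^ n = (1 - Real.exp (-(rate * t))) ^ (n + 1) := by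
  have hd : ∀ y : ℝ, HasDerivAt
      (fun y => -(Real.exp (-(rate * y)) - Real.exp (-(rate * t))) ^ (n + 1))
      (rate * (n + 1) * Real.exp (-(rate * (n + 1) * y)) *
        (1 - Real.exp (-(rate * (t - y)))) ^ n) y := fun y => by
    have h := (((((hasDerivAt_id y).const_mul rate).fun_neg.exp).sub_const
      (Real.exp (-(rate * t)))).fun_pow (n + 1)).fun_neg
    refine h.congr_deriv ?_
    have e1 : Real.exp (-(rate * (n + 1) * y))
        = Real.exp (-(rate * y)) ^ n * Real.exp (-(rate * y)) := by
      rw [← pow_succ, ← Real.exp_nat_mul]; push_cast; ring_nf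
    have e2 : Real.exp (-(rate * y)) - Real.exp (-(rate * t))
        = Real.exp (-(rate * y)) * (1 - Real.exp (-(rate * (t - y)))) := by
      rw [mul_sub, ← Real.exp_add]; ring_nf
    simp only [id, Nat.add_sub_cancel]
    rw [e2, e1, mul_pow]
    push_cast
    ring
  rw [intervalIntegral.integral_eq_sub_of_hasDerivAt (fun y _ => hd y)
    (Continuous.intervalIntegrable (by fun_prop) _ _)]
  simp

/-- The law is that of the maximum of `n` independent exponential variables of parameter `rate`. The
induction conditions on the last holding time. -/
theorem measure_sum_exponential_le [IsProbabilityMeasure μ] {rate : ℝ} (hrate : 0 < rate)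
    {T : ℕ → Ω → ℝ} (hm : ∀ n, Measurable (T n)) (hind : iIndepFun T μ)
    (hlaw : ∀ n : ℕ, μ.map (T n) = expMeasure (rate * (n + 1))) (n : ℕ) (t : ℝ) :
    μ {ω | ∑ i ∈ Finset.range n, T i ω ≤ t}
      = if 0 ≤ t then ENNReal.ofReal ((1 - Real.exp (-(rate * t))) ^ n) else 0 := by
  induction n generalizing t with
  | zero => by_cases h : 0 ≤ t <;> simp [h]
  | succ n ih =>
    set X : Ω → ℝ := fun ω => ∑ i ∈ Finset.range n, T i ω with hX
    have hXm : Measurable X := by fun_prop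
    have hXY : IndepFun X (T n) μ := by
      have h := hind.indepFun_finsetSum_of_notMem hm (s := Finset.range n) (i := n) (by simp)
      convert! h using 1
      ext ω
      simp [hX]
    have hprod := (indepFun_iff_map_prod_eq_prod_map_map hXm.aemeasurable
      (hm n).aemeasurable).mp hXY
    have : IsProbabilityMeasure (μ.map X) := Measure.isProbabilityMeasure_map hXm.aemeasurable
    have : IsProbabilityMeasure (μ.map (T n)) :=
      Measure.isProbabilityMeasure_map (hm n).aemeasurable
    have hset : MeasurableSet {p : ℝ × ℝ | p.1 + p.2 ≤ t} :=
      measurableSet_le (by fun_prop) (by fun_prop)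
    have h1 : μ {ω | ∑ i ∈ Finset.range (n + 1), T i ω ≤ t}
        = ((μ.map X).prod (μ.map (T n))) {p : ℝ × ℝ | p.1 + p.2 ≤ t} := by
      rw [← hprod, Measure.map_apply (by fun_prop) hset]
      congr 1
      ext ω
      simp [hX, Finset.sum_range_succ]
    have h2 : ∀ y, (μ.map X) ((fun x => (x, y)) ⁻¹' {p : ℝ × ℝ | p.1 + p.2 ≤ t})
        = if 0 ≤ t - y then ENNReal.ofReal ((1 - Real.exp (-(rate * (t - y)))) ^ n) else 0 :=
      fun y => by
        rw [Measure.map_apply hXm ((by fun_prop : Measurable fun x : ℝ => (x, y)) hset), ← ih]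
        congr 1
        ext ω
        simp [hX, le_sub_iff_add_le]
    have hdens : μ.map (T n) = volume.withDensity (exponentialPDF (rate * (n + 1))) := hlaw n
    have hpm : Measurable (exponentialPDF (rate * (n + 1))) :=
      (measurable_exponentialPDFReal _).ennreal_ofReal
    have hgm : Measurable fun y : ℝ =>
        if 0 ≤ t - y then ENNReal.ofReal ((1 - Real.exp (-(rate * (t - y)))) ^ n) else 0 :=
      Measurable.ite (measurableSet_le (by fun_prop) (by fun_prop)) (by fun_prop) (by fun_prop)
    rw [h1, Measure.prod_apply_symm hset]
    simp_rw [h2]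
    rw [hdens, lintegral_withDensity_eq_lintegral_mul _ hpm hgm]
    have h3 : ∀ y : ℝ, ((exponentialPDF (rate * (n + 1))) * fun y : ℝ =>
        if 0 ≤ t - y then ENNReal.ofReal ((1 - Real.exp (-(rate * (t - y)))) ^ n) else 0) y
        = (Set.Icc 0 t).indicator (fun y => ENNReal.ofReal
          (rate * (n + 1) * Real.exp (-(rate * (n + 1) * y)) *
            (1 - Real.exp (-(rate * (t - y)))) ^ n)) y := fun y => by
      rw [Pi.mul_apply]
      by_cases hy : 0 ≤ y
      · by_cases hyt : y ≤ t
        · rw [Set.indicator_of_mem (Set.mem_Icc.mpr ⟨hy, hyt⟩), if_pos (by linarith),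
            exponentialPDF_of_nonneg hy, ← ENNReal.ofReal_mul (by positivity)]
        · rw [Set.indicator_of_notMem (fun h => hyt h.2), if_neg (by linarith), mul_zero]
      · rw [Set.indicator_of_notMem (fun h => hy h.1), exponentialPDF_of_neg (not_le.mp hy),
          zero_mul]
    simp_rw [h3]
    rw [lintegral_indicator measurableSet_Icc]
    by_cases ht : 0 ≤ t
    · rw [if_pos ht, ← integral_yule_convolution, intervalIntegral.integral_of_le ht,
        ← integral_Icc_eq_integral_Ioc, ofReal_integral_eq_lintegral_ofReal]
      · exact Continuous.integrableOn_Icc (by fun_prop)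
      · rw [EventuallyLE, ae_restrict_iff' measurableSet_Icc]
        refine ae_of_all _ fun y hy => ?_
        have : Real.exp (-(rate * (t - y))) ≤ 1 :=
          Real.exp_le_one_iff.mpr (by nlinarith [hy.2])
        have : 0 ≤ 1 - Real.exp (-(rate * (t - y))) := by linarith
        simp only [Pi.zero_apply]
        positivity
    · rw [if_neg ht, Set.Icc_eq_empty ht]
      simp

variable {rate : ℝ} {B : ℝ≥0 → Ω → ℕ}

theorem IsYuleProcess.measureReal_lt [IsProbabilityMeasure μ] (hB : IsYuleProcess rate B μ)
    (hrate : 0 < rate) (t : ℝ≥0) (n : ℕ) :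
    μ.real {ω | n < B t ω} = (1 - Real.exp (-(rate * t))) ^ n := by
  obtain ⟨T, hm, hind, hlaw, hT⟩ := hB.holding
  have h : μ {ω | n < B t ω} = μ {ω | ∑ i ∈ Finset.range n, T i ω ≤ (t : ℝ)} := by
    refine measure_congr ?_
    filter_upwards [hT] with ω hω
    exact propext (hω t n)
  have hq : Real.exp (-(rate * t)) ≤ 1 :=
    Real.exp_le_one_iff.mpr (by nlinarith [t.coe_nonneg])
  rw [measureReal_def, h, measure_sum_exponential_le hrate hm hind hlaw, if_pos t.coe_nonneg,
    ENNReal.toReal_ofReal (pow_nonneg (by linarith) n)]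

/-- For `n = 0` the sum of holding times is empty, so almost surely the state exceeds `0`. -/
theorem IsYuleProcess.measureReal_eq_zero [IsProbabilityMeasure μ] (hB : IsYuleProcess rate B μ)
    (hrate : 0 < rate) (t : ℝ≥0) : μ.real {ω | B t ω = 0} = 0 := by
  have h := hB.measureReal_lt hrate t 0
  have hms : MeasurableSet {ω | 0 < B t ω} := measurableSet_lt measurable_const (hB.measurable t)
  have hc := probReal_compl_eq_one_sub (μ := μ) hms
  rw [h, pow_zero, sub_self] at hc
  rw [← hc]
  congr 1
  ext ω
  simp

theorem IsYuleProcess.measureReal_eq_succ [IsProbabilityMeasure μ] (hB : IsYuleProcess rate B μ)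
    (hrate : 0 < rate) (t : ℝ≥0) (n : ℕ) :
    μ.real {ω | B t ω = n + 1}
      = Real.exp (-(rate * t)) * (1 - Real.exp (-(rate * t))) ^ n := by
  have hms : MeasurableSet {ω | n + 1 < B t ω} :=
    measurableSet_lt measurable_const (hB.measurable t)
  have hset : {ω | B t ω = n + 1} = {ω | n < B t ω} \ {ω | n + 1 < B t ω} := by
    ext ω
    simp only [Set.mem_ofPred_eq, Set.mem_sdiff]
    omega
  have hsub : {ω | n + 1 < B t ω} ⊆ {ω | n < B t ω} := fun ω hω => (Nat.lt_succ_self n).trans hω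
  rw [hset, measureReal_sdiff hsub hms,
    hB.measureReal_lt hrate, hB.measureReal_lt hrate]
  ring

end Yule

/-! ### The subordinated process -/

section Subordination
variable {Ω : Type*} [MeasurableSpace Ω] {μ : Measure Ω} {α θ : ℝ} {S : ℝ≥0 → Ω → ℝ}

theorem IsStableProcess.integral_exp (hS : IsStableProcess α θ S μ) (s : ℝ≥0) (ξ : ℝ) :
    ∫ ω, Complex.exp (ξ * S s ω * Complex.I) ∂μ = Complex.exp (-(s : ℂ) * psiSymbol α θ ξ) := by
  have h := hS.charFun_increment 0 s zero_le ξ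
  have hm : Measurable fun ω => S s ω - S 0 ω := (hS.measurable s).sub (hS.measurable 0)
  rw [charFun_apply_real, integral_map hm.aemeasurable (by fun_prop)] at h
  have e : ∫ ω, Complex.exp (ξ * S s ω * Complex.I) ∂μ
      = ∫ ω, Complex.exp (ξ * ((S s ω - S 0 ω : ℝ) : ℂ) * Complex.I) ∂μ := by
    refine integral_congr_ae ?_
    filter_upwards [hS.zero] with ω hω
    rw [hω, sub_zero]
  rw [e, h]
  simp

/-- The random time takes countably many values, so no regularity of the paths of `S` is needed. -/
theorem measurable_subordinated {S : ℝ≥0 → Ω → ℝ} (hS : ∀ t, Measurable (S t)) {N : Ω → ℕ}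
    (hN : Measurable N) (s : ℝ≥0) : Measurable fun ω => S (s + (N ω : ℝ≥0)) ω := by
  have : Measurable (fun p : Ω × ℕ => S (s + (p.2 : ℝ≥0)) p.1) :=
    measurable_from_prod_countable_left fun n => hS (s + (n : ℝ≥0))
  exact this.comp (measurable_id.prodMk hN)

/-- Splitting over the values `k` of the birth process and using independence gives a geometric
series of ratio `(1 - q) e^{-ψ}`, of modulus `< 1`. -/
theorem charFun_subordinated [IsProbabilityMeasure μ] (h1 : 1 < α) (h2 : α ≤ 2) {rate : ℝ}
    (hrate : 0 < rate) {B : ℝ≥0 → Ω → ℕ} (hB : IsYuleProcess rate B μ)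
    (hSB : IndepFun (fun ω (s : ℝ≥0) => S s ω) (fun ω (t : ℝ≥0) => B t ω) μ)
    (hS : IsStableProcess α (2 - α) S μ) (a t : ℝ≥0) (ξ : ℝ) :
    charFun (μ.map fun ω => S (a * t + (B t ω : ℝ≥0)) ω) ξ = yuleStable α a rate t ξ := by
  have hYm := measurable_subordinated hS.measurable (hB.measurable t) (a * t)
  rw [charFun_apply_real, integral_map hYm.aemeasurable (by fun_prop)]
  set f : Ω → ℂ := fun ω => Complex.exp (ξ * S (a * t + (B t ω : ℝ≥0)) ω * Complex.I) with hf
  have hfm : Measurable f :=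
    (((Complex.measurable_ofReal.comp hYm).const_mul (ξ : ℂ)).mul_const Complex.I).cexp
  have hfi : Integrable f μ := (integrable_const (1 : ℝ)).mono' hfm.aestronglyMeasurable
    (ae_of_all _ fun ω => by simp [hf, Complex.norm_exp])
  have hms : ∀ k, MeasurableSet {ω | B t ω = k} := fun k =>
    hB.measurable t (measurableSet_singleton k)
  have hU : (⋃ k, {ω | B t ω = k}) = Set.univ := by
    ext ω; simp
  have hsum := hasSum_integral_iUnion (μ := μ) (f := f) hms
    (fun i j hij => Set.disjoint_left.mpr fun ω hi hj => hij (hi.symm.trans hj))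
    (by rw [hU]; exact hfi.integrableOn)
  rw [hU, setIntegral_univ] at hsum
  have hterm : ∀ k : ℕ, ∫ ω in {ω | B t ω = k}, f ω ∂μ
      = μ.real {ω | B t ω = k} * expPsi α (a * t + k) ξ := fun k => by
    have hind : IndepFun (fun ω => if B t ω = k then (1 : ℂ) else 0)
        (fun ω => Complex.exp (ξ * S (a * t + (k : ℝ≥0)) ω * Complex.I)) μ := by
      have hu : Measurable (fun s : ℝ≥0 → ℝ =>
          Complex.exp (ξ * s (a * t + (k : ℝ≥0)) * Complex.I)) := by fun_prop
      have hk : Measurable (fun b : ℕ => if b = k then (1 : ℂ) else 0) := measurable_from_top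
      have hv : Measurable (fun b : ℝ≥0 → ℕ => if b t = k then (1 : ℂ) else 0) :=
        hk.comp (measurable_pi_apply t)
      exact (hSB.comp hu hv).symm
    have hm1 : Measurable (fun ω => if B t ω = k then (1 : ℂ) else 0) :=
      Measurable.ite (hms k) measurable_const measurable_const
    have hm2 : Measurable (fun ω => Complex.exp (ξ * S (a * t + (k : ℝ≥0)) ω * Complex.I)) := by
      have := hS.measurable (a * t + (k : ℝ≥0))
      fun_prop
    have hmul := hind.integral_fun_mul_eq_mul_integral hm1.aestronglyMeasurable
      hm2.aestronglyMeasurable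
    have e1 : ∫ ω, (if B t ω = k then (1 : ℂ) else 0) ∂μ = μ.real {ω | B t ω = k} := by
      have := integral_indicator_const (μ := μ) (1 : ℂ) (hms k)
      rw [Complex.real_smul, mul_one] at this
      rw [← this]
      congr 1 with ω
      simp [Set.indicator_apply]
    rw [hS.integral_exp, e1] at hmul
    have e2 : expPsi α (a * t + k) ξ
        = Complex.exp (-((a * t + (k : ℝ≥0) : ℝ≥0) : ℂ) * psiSymbol α (2 - α) ξ) := by
      rw [expPsi]; push_cast; rfl
    rw [e2, ← hmul, ← integral_indicator (hms k)]
    congr 1 with ω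
    by_cases hω : B t ω = k
    · simp [hf, hω]
    · simp [hω]
  simp_rw [hterm] at hsum
  -- The term `k = 0` vanishes; the shifted index `k = n + 1` accounts for the `1` in the exponent
  -- `1 + at`.
  rw [← hsum.tsum_eq, hsum.summable.tsum_eq_zero_add]
  rw [hB.measureReal_eq_zero hrate]
  simp_rw [hB.measureReal_eq_succ hrate]
  set q := Real.exp (-(rate * t)) with hq
  have hq0 : 0 < q := Real.exp_pos _
  have hz := norm_expPsi_le_one h1 h2 zero_le_one ξ
  have hqt : q ≤ 1 := Real.exp_le_one_iff.mpr (by nlinarith [t.coe_nonneg])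
  have hr : ‖(1 - (q : ℂ)) * expPsi α 1 ξ‖ < 1 := by
    rw [norm_mul, ← Complex.ofReal_one, ← Complex.ofReal_sub, Complex.norm_real,
      Real.norm_of_nonneg (by linarith)]
    nlinarith [norm_nonneg (expPsi α 1 ξ)]
  have hexp : ∀ n : ℕ, ((q * (1 - q) ^ n : ℝ) : ℂ) * expPsi α (a * t + ((n + 1 : ℕ) : ℝ)) ξ
      = q * expPsi α (1 + a * t) ξ * ((1 - (q : ℂ)) * expPsi α 1 ξ) ^ n := fun n => by
    have : expPsi α (a * t + ((n + 1 : ℕ) : ℝ)) ξ = expPsi α (1 + a * t) ξ * expPsi α 1 ξ ^ n := by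
      rw [expPsi, expPsi, expPsi, ← Complex.exp_nat_mul, ← Complex.exp_add]
      push_cast
      ring_nf
    rw [this, mul_pow]
    push_cast
    ring
  simp_rw [hexp]
  rw [tsum_mul_left, tsum_geometric_of_norm_lt_one hr, yuleStable, yuleDenom, ← hq]
  simp
  ring

end Subordination

/-! ### The pseudo-differential operators on inverse Fourier transforms -/

section Operators
variable {α : ℝ} (h1 : 1 < α) (h2 : α ≤ 2) {g : ℝ → ℂ} (hg : ExpDecay g)
include h1 h2 hg

theorem isRieszFeller_invFourierPos :
    IsRieszFeller α (2 - α) (invFourierPos g)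
      (invFourierPos fun ξ => -psiSymbol α (2 - α) ξ * g ξ) :=
  hg.isFourierMultiplier (polyGrowth_psiSymbol h1 h2).neg

theorem isRieszFellerIterates_invFourierPos :
    IsRieszFellerIterates α (2 - α) (invFourierPos g)
      (fun n => invFourierPos fun ξ => (-psiSymbol α (2 - α) ξ) ^ n * g ξ) := by
  refine ⟨by simp, fun n => ?_⟩
  have h := isRieszFeller_invFourierPos h1 h2
    (hg.mul ((polyGrowth_psiSymbol h1 h2).neg.pow n))
  simpa only [← mul_assoc, ← pow_succ'] using h

/-- On the Fourier side the series is the scalar exponential series at each frequency, so no size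
condition on `g` beyond `ExpDecay` is needed. -/
theorem isFractionalShift_invFourierPos :
    IsFractionalShift α (2 - α) 1 (invFourierPos g)
      (invFourierPos fun ξ => expPsi α 1 ξ * g ξ) := by
  have hz := hg.mul (polyGrowth_expPsi h1 h2 zero_le_one)
  refine ⟨_, isRieszFellerIterates_invFourierPos h1 h2 hg, hz.integrable_invFourierPos,
    hz.continuous_invFourierPos, fun ξ => ?_⟩
  rw [hz.fourierPos_invFourierPos]
  simp_rw [fun n => (hg.mul ((polyGrowth_psiSymbol h1 h2).neg.pow n)).fourierPos_invFourierPos ξ]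
  have h := (NormedSpace.expSeries_div_hasSum_exp (-psiSymbol α (2 - α) ξ)).mul_right (g ξ)
  rw [← Complex.exp_eq_exp_ℂ] at h
  convert! h using 1
  · ext n
    push_cast
    rw [one_pow]
    ring
  · simp [expPsi]

theorem isUniformFractionalShift_invFourierPos {K : ℝ}
    (hK : ∀ ξ, ‖g ξ‖ ≤ K * Real.exp (-|ξ| ^ α)) :
    IsUniformFractionalShift α (2 - α) 1 (invFourierPos g)
      (invFourierPos fun ξ => expPsi α 1 ξ * g ξ) :=
  ⟨_, isRieszFellerIterates_invFourierPos h1 h2 hg, by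
    simpa only [one_pow] using tendstoUniformly_exp_series h1 h2 hg hK⟩

end Operators

/-- This turns the condition `c cos(πθ/2) ≥ 1` into the weight `e^{-|ξ|^α}` of the uniform
convergence lemma. -/
theorem norm_le_of_one_le_cos {α : ℝ} (h1 : 1 < α) {g : ℝ → ℂ} {K c : ℝ}
    (hK : ∀ ξ, ‖g ξ‖ ≤ K * ‖expPsi α c ξ‖)
    (hc : 1 ≤ c * Real.cos ((2 - α) * Real.pi / 2)) (ξ : ℝ) :
    ‖g ξ‖ ≤ K * Real.exp (-|ξ| ^ α) := by
  have hK0 : 0 ≤ K := by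
    by_contra! h
    have := hK 0
    have h3 : 0 < ‖expPsi α c 0‖ := norm_pos_iff.mpr (Complex.exp_ne_zero _)
    nlinarith [norm_nonneg (g 0)]
  refine (hK ξ).trans (mul_le_mul_of_nonneg_left ?_ hK0)
  rw [norm_expPsi h1, Real.exp_le_exp]
  have : 0 ≤ |ξ| ^ α := by positivity
  nlinarith

/-! ### Ordinary derivatives for `α = 2` -/

theorem psiSymbol_two_zero (ξ : ℝ) : psiSymbol 2 (2 - 2) ξ = (ξ : ℂ) ^ 2 := by
  simp [psiSymbol]

theorem ExpDecay.iteratedDeriv_invFourierPos {g : ℝ → ℂ} (hg : ExpDecay g) (n : ℕ) :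
    iteratedDeriv n (invFourierPos g) = invFourierPos fun ξ => (-Complex.I * ξ) ^ n * g ξ := by
  induction n with
  | zero => simp
  | succ n ih =>
    rw [iteratedDeriv_succ, ih]
    ext x
    rw [((hg.mul (PolyGrowth.neg_I_mul.pow n)).hasDerivAt_invFourierPos x).deriv]
    simp only [← mul_assoc, ← pow_succ']

theorem ExpDecay.iteratedDeriv_two_mul_invFourierPos {g : ℝ → ℂ} (hg : ExpDecay g) (n : ℕ) :
    iteratedDeriv (2 * n) (invFourierPos g)
      = invFourierPos fun ξ => (-psiSymbol 2 (2 - 2) ξ) ^ n * g ξ := by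
  rw [hg.iteratedDeriv_invFourierPos]
  congr 1 with ξ
  rw [pow_mul, psiSymbol_two_zero, mul_pow, neg_sq, Complex.I_sq, neg_one_mul]

theorem ExpDecay.isExpSecondDeriv_invFourierPos {g : ℝ → ℂ} (hg : ExpDecay g) {K : ℝ}
    (hK : ∀ ξ, ‖g ξ‖ ≤ K * Real.exp (-|ξ| ^ (2 : ℝ))) :
    IsExpSecondDeriv (invFourierPos g) (invFourierPos fun ξ => expPsi 2 1 ξ * g ξ) where
  smooth := contDiff_of_differentiable_iteratedDeriv fun n _ => by
    rw [hg.iteratedDeriv_invFourierPos]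
    exact fun x =>
      ((hg.mul (PolyGrowth.neg_I_mul.pow n)).hasDerivAt_invFourierPos x).differentiableAt
  integrable n := by
    rw [hg.iteratedDeriv_invFourierPos]
    exact (hg.mul (PolyGrowth.neg_I_mul.pow _)).integrable_invFourierPos
  tendsto := by
    simp only [hg.iteratedDeriv_two_mul_invFourierPos]
    simpa only [one_div, inv_mul_eq_div] using
      tendstoUniformly_exp_series one_lt_two le_rfl hg hK

/-! ### The density of the subordinated process -/

section Density
variable {Ω : Type*} [MeasurableSpace Ω] {μ : Measure Ω} [IsProbabilityMeasure μ] {α : ℝ}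
  {S : ℝ≥0 → Ω → ℝ} {rate : ℝ} {B : ℝ≥0 → Ω → ℕ} (h1 : 1 < α) (h2 : α ≤ 2)
  (hrate : 0 < rate) (hB : IsYuleProcess rate B μ)
  (hSB : IndepFun (fun ω (s : ℝ≥0) => S s ω) (fun ω (t : ℝ≥0) => B t ω) μ)
  (hS : IsStableProcess α (2 - α) S μ) (a t : ℝ≥0)
include h1 h2 hrate

theorem isContinuousDensity_of_charFun_eq_yuleStable {ν : Measure ℝ} [IsProbabilityMeasure ν]
    (hν : ∀ ξ, charFun ν ξ = yuleStable α a rate t ξ) :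
    IsContinuousDensity ν (invFourierPos (yuleStable α a rate t)) := by
  have hφ := expDecay_yuleStable h1 h2 a.coe_nonneg hrate t.coe_nonneg
  refine isContinuousDensity_of_charFun hφ.continuous_invFourierPos hφ.integrable_invFourierPos
    fun ξ => ?_
  rw [hν, hφ.fourierPos_invFourierPos]

include hB hSB hS

theorem isContinuousDensity_subordinated :
    IsContinuousDensity (μ.map fun ω => S (a * t + (B t ω : ℝ≥0)) ω)
      (invFourierPos (yuleStable α a rate t)) := by
  have := Measure.isProbabilityMeasure_map (μ := μ)
    (measurable_subordinated hS.measurable (hB.measurable t) (a * t)).aemeasurable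
  exact isContinuousDensity_of_charFun_eq_yuleStable h1 h2 hrate a t
    (charFun_subordinated h1 h2 hrate hB hSB hS a t)

omit hB hSB in
theorem isContinuousDensity_subordinated_zero :
    IsContinuousDensity (μ.map (S 1)) (invFourierPos (yuleStable α a rate 0)) := by
  have := Measure.isProbabilityMeasure_map (μ := μ) (hS.measurable 1).aemeasurable
  refine isContinuousDensity_of_charFun_eq_yuleStable h1 h2 hrate a 0 fun ξ => ?_
  rw [charFun_apply_real, integral_map (hS.measurable 1).aemeasurable (by fun_prop),
    hS.integral_exp]
  simp [yuleStable, yuleDenom, expPsi]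

theorem integrable_mul_density :
    Integrable fun x => x * invFourierPos (yuleStable α a rate t) x := by
  have hY := (measurable_subordinated hS.measurable (hB.measurable t) (a * t)).aemeasurable (μ := μ)
  have := Measure.isProbabilityMeasure_map hY
  obtain ⟨C, hC⟩ := norm_one_sub_yuleStable_le h1 h2 a.coe_nonneg hrate t.coe_nonneg
  refine (isContinuousDensity_subordinated h1 h2 hrate hB hSB hS a t).integrable_mul
    (integrable_id_of_charFun h1 (C := C) fun ξ => ?_)
  rw [charFun_subordinated h1 h2 hrate hB hSB hS]
  exact hC ξ

/-- Two computations of the frequency derivative of `φ`: under the integral defining it, thanks to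
the first moment, and by the chain rule through `ψ`. -/
theorem fourierPos_mul_density (ξ : ℝ) :
    fourierPos (fun x => x * invFourierPos (yuleStable α a rate t) x) ξ
      = -Complex.I * (yuleStableDeriv α a rate t ξ * psiDeriv α ξ) := by
  have hφ := expDecay_yuleStable h1 h2 a.coe_nonneg hrate t.coe_nonneg
  have h := hasDerivAt_fourierPos hφ.integrable_invFourierPos
    (integrable_mul_density h1 h2 hrate hB hSB hS a t) ξ
  rw [show fourierPos (invFourierPos (yuleStable α a rate t)) = yuleStable α a rate t from
    funext hφ.fourierPos_invFourierPos] at h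
  rw [← h.unique (hasDerivAt_yuleStable h1 h2 a hrate t.coe_nonneg ξ), ← mul_assoc]
  simp

theorem isFellerIntegral_mul_density :
    IsFellerIntegral (α - 1) (1 - α) (fun x => x * invFourierPos (yuleStable α a rate t) x)
      (invFourierPos fun ξ => (α : ℂ) * yuleStableDeriv α a rate t ξ) := by
  have hχ := (expDecay_yuleStableDeriv h1 h2 a.coe_nonneg hrate t.coe_nonneg).mul
    (PolyGrowth.const α)
  refine ⟨integrable_mul_density h1 h2 hrate hB hSB hS a t, hχ.integrable_invFourierPos,
    hχ.continuous_invFourierPos, fun ξ hξ => ?_⟩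
  rw [hχ.fourierPos_invFourierPos, fourierPos_mul_density h1 h2 hrate hB hSB hS, psiDeriv]
  have hp : |ξ| ^ (-(α - 1)) * (|ξ| ^ (α - 2) * ξ) = Real.sign ξ := by
    rw [← mul_assoc, ← Real.rpow_add (by positivity),
      show -(α - 1) + (α - 2) = -1 by ring, Real.rpow_neg_one]
    rcases lt_or_gt_of_ne hξ with h | h
    · rw [abs_of_neg h, Real.sign_of_neg h]; field_simp
    · rw [abs_of_pos h, Real.sign_of_pos h]; field_simp
  -- The phases add up to `sign(ξ) π/2` because `(α - 1) + (2 - α) = 1`; the resulting `i sign(ξ)`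
  -- cancels the `-i` of the transform and the sign of `ψ'`.
  have he : Complex.exp (-(Complex.I * ((Real.pi * (1 - α) * Real.sign ξ / 2 : ℝ) : ℂ))) *
      Complex.exp (Complex.I * ((Real.sign ξ * (2 - α) * Real.pi / 2 : ℝ) : ℂ))
      = Complex.I * Real.sign ξ := by
    rw [← Complex.exp_add]
    have : -(Complex.I * ((Real.pi * (1 - α) * Real.sign ξ / 2 : ℝ) : ℂ)) +
        Complex.I * ((Real.sign ξ * (2 - α) * Real.pi / 2 : ℝ) : ℂ)
        = Real.sign ξ * (Real.pi / 2 * Complex.I) := by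
      push_cast; ring
    rw [this]
    rcases lt_or_gt_of_ne hξ with h | h
    · rw [Real.sign_of_neg h]
      simp [Complex.exp_neg, Complex.exp_pi_div_two_mul_I]
    · rw [Real.sign_of_pos h]
      simp [Complex.exp_pi_div_two_mul_I]
  have hs : (Real.sign ξ : ℂ) * Real.sign ξ = 1 := by
    rcases lt_or_gt_of_ne hξ with h | h
    · rw [Real.sign_of_neg h]; simp
    · rw [Real.sign_of_pos h]; simp
  have hp' : ((|ξ| ^ (-(α - 1)) : ℝ) : ℂ) * ((|ξ| ^ (α - 2) : ℝ) * ξ) = Real.sign ξ := by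
    rw [← hp]; push_cast; rfl
  push_cast at hp' he ⊢
  set χ := yuleStableDeriv α a rate t ξ
  set E1 := Complex.exp (-(Complex.I * (Real.pi * (1 - α) * Real.sign ξ / 2)))
  set E2 := Complex.exp (Complex.I * (Real.sign ξ * (2 - α) * Real.pi / 2))
  set A := ((|ξ| ^ (-(α - 1)) : ℝ) : ℂ)
  set D := ((|ξ| ^ (α - 2) : ℝ) : ℂ)
  calc (α : ℂ) * χ = -(Complex.I * Complex.I) * α * χ *
        ((Real.sign ξ : ℂ) * Real.sign ξ) := by rw [hs, Complex.I_mul_I]; ring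
    _ = -Complex.I * α * χ * (A * (D * ξ)) * (Complex.I * Real.sign ξ) := by rw [hp']; ring
    _ = -Complex.I * α * χ * (A * (D * ξ)) * (E1 * E2) := by rw [he]
    _ = _ := by ring

end Density

/-! ### Fourier uniqueness and the primitive for `α = 2` -/

open FourierTransform in
theorem eq_of_fourierPos_eq {f g : ℝ → ℝ} (hfc : Continuous f) (hgc : Continuous g)
    (hf : Integrable f) (hg : Integrable g) (h : ∀ ξ, fourierPos f ξ = fourierPos g ξ) : f = g := by
  have h0 : 𝓕⁻ (fun x => ((f x - g x : ℝ) : ℂ)) = 0 := by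
    ext ξ
    have e := ExpDecay.fourierPos_eq_fourierInv (fun x => f x - g x) (2 * Real.pi * ξ)
    rw [mul_div_cancel_left₀ _ (by positivity)] at e
    rw [← e, fourierPos]
    simp only [Complex.ofReal_sub, mul_sub]
    rw [integral_sub (integrable_exp_I_mul hf _) (integrable_exp_I_mul hg _), sub_eq_zero.mpr]
    · rfl
    · exact h _
  -- Inversion requires an integrable transform; here the transform of the difference is zero.
  have hinv := (show Continuous fun x => ((f x - g x : ℝ) : ℂ) by fun_prop).fourierInv_fourier_eq
    (hf.sub hg).ofReal (by
      rw [show 𝓕 (fun x => ((f x - g x : ℝ) : ℂ)) = fun ξ => 𝓕⁻ (fun x => ((f x - g x : ℝ) : ℂ)) (-ξ)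
        by ext ξ; rw [Real.fourierInv_eq_fourier_neg, neg_neg], h0]
      exact integrable_zero _ _ _)
  rw [← Real.fourierInv_comm, h0] at hinv
  ext x
  have hx := congrFun hinv x
  rw [Real.fourier_eq'] at hx
  simp only [Pi.zero_apply, smul_zero, integral_zero] at hx
  exact sub_eq_zero.mp (Complex.ofReal_eq_zero.mp hx.symm)

/-- For `α = 2` the Feller integral is the primitive vanishing at `-∞`. -/
theorem setIntegral_Iic_mul_density {Ω : Type*} [MeasurableSpace Ω] {μ : Measure Ω}
    [IsProbabilityMeasure μ] {S : ℝ≥0 → Ω → ℝ} {rate : ℝ} {B : ℝ≥0 → Ω → ℕ}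
    (hrate : 0 < rate) (hB : IsYuleProcess rate B μ)
    (hSB : IndepFun (fun ω (s : ℝ≥0) => S s ω) (fun ω (t : ℝ≥0) => B t ω) μ)
    (hS : IsStableProcess 2 (2 - 2) S μ) (a t : ℝ≥0) (x : ℝ) :
    ∫ z in Set.Iic x, z * invFourierPos (yuleStable 2 a rate t) z
      = invFourierPos (fun ξ => ((2 : ℝ) : ℂ) * yuleStableDeriv 2 a rate t ξ) x := by
  have hφ := expDecay_yuleStable one_lt_two le_rfl a.coe_nonneg hrate t.coe_nonneg
  have hχ := (expDecay_yuleStableDeriv one_lt_two le_rfl a.coe_nonneg hrate t.coe_nonneg).mul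
    (PolyGrowth.const 2)
  have hxu := integrable_mul_density one_lt_two le_rfl hrate hB hSB hS a t
  have hd := hχ.mul PolyGrowth.neg_I_mul
  -- With `ψ' = 2ξ` the transform of `z u` is `-iξ · 2 ∂_ψ φ`, so `z u` is the derivative of the
  -- inverse transform of `2 ∂_ψ φ`. That function and its derivative are integrable, so it vanishes
  -- at `-∞`.
  have he : (fun z => z * invFourierPos (yuleStable 2 a rate t) z)
      = invFourierPos fun ξ => -Complex.I * ξ * (((2 : ℝ) : ℂ) * yuleStableDeriv 2 a rate t ξ) := by
    refine eq_of_fourierPos_eq (continuous_id.mul hφ.continuous_invFourierPos)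
      hd.continuous_invFourierPos hxu hd.integrable_invFourierPos fun ξ => ?_
    rw [fourierPos_mul_density one_lt_two le_rfl hrate hB hSB hS, hd.fourierPos_invFourierPos,
      psiDeriv]
    simp
    ring
  rw [he] at hxu ⊢
  have hder := hχ.hasDerivAt_invFourierPos
  have hlim := tendsto_zero_of_hasDerivAt_of_integrableOn_Iic (a := x) (fun y _ => hder y)
    hxu.integrableOn hχ.integrable_invFourierPos.integrableOn
  rw [integral_Iic_of_hasDerivAt_of_tendsto' (fun y _ => hder y) hxu.integrableOn hlim, sub_zero]

/-! ### The main theorem -/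

theorem theorem18 {Ω : Type*} [MeasurableSpace Ω] (μ : Measure Ω) [IsProbabilityMeasure μ]
    (a : ℝ≥0) (rate : ℝ) (hrate : 0 < rate)
    (S : ℝ≥0 → Ω → ℝ) (B : ℝ≥0 → Ω → ℕ) (hB : IsYuleProcess rate B μ)
    (hSB : IndepFun (fun ω (s : ℝ≥0) => S s ω) (fun ω (t : ℝ≥0) => B t ω) μ) :
    (∀ α : ℝ, 1 < α → α < 2 → IsStableProcess α (2 - α) S μ →
      ∃ u : ℝ → ℝ → ℝ,
        (∀ t : ℝ≥0, IsContinuousDensity (μ.map (fun ω => S (a * t + (B t ω : ℝ≥0)) ω)) (u t)) ∧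
        IsContinuousDensity (μ.map (S 1)) (u 0) ∧
        ∀ t : ℝ, 0 ≤ t →
          ∃ Du Ou J OJ : ℝ → ℝ,
            IsRieszFeller α (2 - α) (u t) Du ∧
            IsFractionalShift α (2 - α) 1 (u t) Ou ∧
            IsFellerIntegral (α - 1) (1 - α) (fun x => x * u t x) J ∧
            IsFractionalShift α (2 - α) 1 J OJ ∧
            (1 ≤ (1 + a * t) * Real.cos ((2 - α) * Real.pi / 2) →
              IsUniformFractionalShift α (2 - α) 1 (u t) Ou ∧
              IsUniformFractionalShift α (2 - α) 1 J OJ) ∧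
            ∀ x : ℝ, HasDerivWithinAt (fun s : ℝ => u s x)
              (a * (Du x + rate * t * (u t x - Ou x)) + rate / α * (J x - OJ x))
              (Set.Ici 0) t) ∧
    (IsStableProcess 2 0 S μ →
      ∃ u : ℝ → ℝ → ℝ,
        (∀ t : ℝ≥0, IsContinuousDensity (μ.map (fun ω => S (a * t + (B t ω : ℝ≥0)) ω)) (u t)) ∧
        (∀ x : ℝ, u 0 x = gaussianPDFReal 0 2 x) ∧
        ∀ t : ℝ, 0 ≤ t →
          ∃ Eu EW : ℝ → ℝ,
            IsExpSecondDeriv (u t) Eu ∧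
            Integrable (fun z => z * u t z) ∧
            IsExpSecondDeriv (fun x => ∫ z in Set.Iic x, z * u t z) EW ∧
            ∀ x : ℝ, HasDerivWithinAt (fun s : ℝ => u s x)
              (a * (iteratedDeriv 2 (u t) x + rate * t * (u t x - Eu x))
                + rate / 2 * ((∫ z in Set.Iic x, z * u t z) - EW x))
              (Set.Ici 0) t) := by
  -- One equation serves both cases; the factor `α` moved inside the transform matches the Feller
  -- integral.
  have key : ∀ α : ℝ, 1 < α → α ≤ 2 → ∀ (t : ℝ≥0) (x : ℝ),
      HasDerivWithinAt (fun s : ℝ => invFourierPos (yuleStable α a rate s) x)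
        (a * (invFourierPos (fun ξ => -psiSymbol α (2 - α) ξ * yuleStable α a rate t ξ) x
            + rate * t * (invFourierPos (yuleStable α a rate t) x
              - invFourierPos (fun ξ => expPsi α 1 ξ * yuleStable α a rate t ξ) x))
          + rate / α * (invFourierPos (fun ξ => (α : ℂ) * yuleStableDeriv α a rate t ξ) x
            - invFourierPos (fun ξ => expPsi α 1 ξ * ((α : ℂ) * yuleStableDeriv α a rate t ξ)) x))
        (Set.Ici 0) t := by
    intro α h1 h2 t x
    refine ((hasDerivAt_invFourierPos_yuleStable h1 h2 a.coe_nonneg hrate t.coe_nonneg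
      x).hasDerivWithinAt).congr_deriv ?_
    simp only [mul_left_comm _ (α : ℂ)]
    rw [invFourierPos_const_mul, invFourierPos_const_mul]
    have : α ≠ 0 := by linarith
    field_simp
  constructor
  · intro α h1 h2' hS
    have h2 := h2'.le
    refine ⟨fun t => invFourierPos (yuleStable α a rate t),
      fun t => isContinuousDensity_subordinated h1 h2 hrate hB hSB hS a t,
      isContinuousDensity_subordinated_zero h1 h2 hrate hS a, fun t ht => ?_⟩
    lift t to ℝ≥0 using ht
    have hφ := expDecay_yuleStable h1 h2 a.coe_nonneg hrate t.coe_nonneg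
    have hχ := (expDecay_yuleStableDeriv h1 h2 a.coe_nonneg hrate t.coe_nonneg).mul
      (PolyGrowth.const α)
    obtain ⟨K, hK⟩ := exists_norm_yuleStable_le h1 h2 a hrate t.coe_nonneg
    obtain ⟨K', hK'⟩ := exists_norm_yuleStableDeriv_le h1 h2 a hrate t.coe_nonneg
    refine ⟨_, _, _, _, isRieszFeller_invFourierPos h1 h2 hφ,
      isFractionalShift_invFourierPos h1 h2 hφ,
      isFellerIntegral_mul_density h1 h2 hrate hB hSB hS a t,
      isFractionalShift_invFourierPos h1 h2 hχ, fun hcos => ⟨?_, ?_⟩, key α h1 h2 t⟩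
    · exact isUniformFractionalShift_invFourierPos h1 h2 hφ (norm_le_of_one_le_cos h1 hK hcos)
    · refine isUniformFractionalShift_invFourierPos h1 h2 hχ (K := ‖(α : ℂ)‖ * K')
        (norm_le_of_one_le_cos h1 (fun ξ => ?_) hcos)
      rw [norm_mul, mul_assoc]
      gcongr
      exact hK' ξ
  · intro hS
    rw [show (0 : ℝ) = 2 - 2 by norm_num] at hS
    refine ⟨fun t => invFourierPos (yuleStable 2 a rate t),
      fun t => isContinuousDensity_subordinated one_lt_two le_rfl hrate hB hSB hS a t,
      fun x => ?_, fun t ht => ?_⟩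
    · have hu := isContinuousDensity_subordinated_zero one_lt_two le_rfl hrate hS a
      -- The characteristic function `e^{-ξ²}` corresponds to variance `2`.
      have hgauss : μ.map (S 1) = gaussianReal 0 2 := by
        have := Measure.isProbabilityMeasure_map (μ := μ) (hS.measurable 1).aemeasurable
        refine Measure.ext_of_charFun (funext fun ξ => ?_)
        rw [charFun_gaussianReal, charFun_apply_real,
          integral_map (hS.measurable 1).aemeasurable (by fun_prop), hS.integral_exp,
          psiSymbol_two_zero]
        congr 1
        push_cast
        ring
      have hg : IsContinuousDensity (μ.map (S 1)) (gaussianPDFReal 0 2) :=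
        ⟨by unfold gaussianPDFReal; fun_prop, gaussianPDFReal_nonneg 0 2, by
          rw [hgauss, gaussianReal_of_var_ne_zero 0 two_ne_zero]
          rfl⟩
      exact congrFun (hu.unique hg) x
    · lift t to ℝ≥0 using ht
      have hφ := expDecay_yuleStable one_lt_two le_rfl a.coe_nonneg hrate t.coe_nonneg
      have hχ := (expDecay_yuleStableDeriv one_lt_two le_rfl a.coe_nonneg hrate
        t.coe_nonneg).mul (PolyGrowth.const 2)
      obtain ⟨K, hK⟩ := exists_norm_yuleStable_le one_lt_two le_rfl a hrate t.coe_nonneg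
      obtain ⟨K', hK'⟩ := exists_norm_yuleStableDeriv_le one_lt_two le_rfl a hrate t.coe_nonneg
      -- The cosine is `1`, so uniform convergence holds for every `t ≥ 0`.
      have hcos : 1 ≤ (1 + a * t : ℝ) * Real.cos ((2 - 2) * Real.pi / 2) := by
        have : (0 : ℝ) ≤ a * t := by positivity
        simpa using this
      have hW := funext (setIntegral_Iic_mul_density hrate hB hSB hS a t)
      refine ⟨_,
        invFourierPos fun ξ => expPsi 2 1 ξ * (((2 : ℝ) : ℂ) * yuleStableDeriv 2 a rate t ξ),
        hφ.isExpSecondDeriv_invFourierPos (norm_le_of_one_le_cos one_lt_two hK hcos),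
        integrable_mul_density one_lt_two le_rfl hrate hB hSB hS a t, ?_, fun x => ?_⟩
      · rw [hW]
        refine hχ.isExpSecondDeriv_invFourierPos (K := ‖((2 : ℝ) : ℂ)‖ * K')
          (norm_le_of_one_le_cos one_lt_two (fun ξ => ?_) hcos)
        rw [norm_mul, mul_assoc]
        gcongr
        exact hK' ξ
      · have hD := hφ.iteratedDeriv_two_mul_invFourierPos 1
        simp only [mul_one, pow_one] at hD
        rw [hD, congrFun hW x]
        exact key 2 one_lt_two le_rfl t x
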